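/- Let $r\ge 1$ and let $1\le k\le n$ be integers. **Words and colored ordered multiset partitions.** An $r$-colored letter is $i^c$ with $i\in\mathbb Z_{>0}$ and color $c\in\{0,\dots,r-1\}$. Order the letters by $1^{r-1}<2^{r-1}<\cdots<1^{r-2}<2^{r-2}<\cdots<1^0<2^0<\cdots$. For a word $w=w_1\cdots w_n$ of $r$-colored letters let $\mathrm{Des}(w)=\{1\le i\le n-1: w_i>w_{i+1}\}$. An $r$-colored ordered multiset partition $\mu=(M_1,\dots,M_k)$ of size $n$ with $k$ blocks is a sequence of $k$ finite nonempty sets of $r$-colored letters with $|M_1|+\cdots+|M_k|=n$. Let $w$ be the word obtained by writing each block in decreasing order and concatenating the blocks, let $S$ be the set of $1\le i\le n-1$ such that positions $i$ and $i+1$ of $w$ belong to the same block, and let $c(\mu)$ be the sum of all colors. Put $$\mathrm{maj}(\mu)=c(\mu)+r\Big[\sum_{i\in\mathrm{Des}(w)}i-\sum_{i\in S}\big|\mathrm{Des}(w)\cap\{i,i+1,\dots,n\}\big|\Big].$$ **Symmetric functions.** Let $\mathbf x=(\mathbf x^{(1)},\dots,\mathbf x^{(r)})$ with $\mathbf x^{(i)}=(x^{(i)}_1,x^{(i)}_2,\dots)$,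 and let $\Lambda^r(\mathbf x)$ be the space of formal power series of bounded degree which are symmetric in each of $\mathbf x^{(1)},\dots,\mathbf x^{(r)}$ separately. For an $r$-tuple of partitions $\boldsymbol\lambda=(\lambda^{(1)},\dots,\lambda^{(r)})$ let $\boldsymbol\lambda'$ be its componentwise conjugate and $\boldsymbol s_{\boldsymbol\lambda}(\mathbf x)=s_{\lambda^{(1)}}(\mathbf x^{(1)})\cdots s_{\lambda^{(r)}}(\mathbf x^{(r)})$. Let $\omega$ be the linear map on $\Lambda^r(\mathbf x)$ with $\omega(\boldsymbol s_{\boldsymbol\lambda})=\boldsymbol s_{\boldsymbol\lambda'}$ for all $\boldsymbol\lambda$, extended linearly over scalars in $q$. Let $\mathrm{rev}_q$ be the operator which reverses the coefficient sequence of a polynomial in $q$: $\mathrm{rev}_q P(q)=q^{\deg P}P(q^{-1})$. Define $$\boldsymbol M_{n,k}(\mathbf x;q)=\sum_\mu q^{\mathrm{maj}(\mu)}\mathbf x^\mu,\qquad \boldsymbol D_{n,k}(\mathbf x;q)=(\mathrm{rev}_q\circ\omega)\,\boldsymbol M_{n,k}(\mathbf x;q),$$ where $\mu$ ranges over the $r$-colored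 ordered multiset partitions of size $n$ with $k$ blocks, and the exponent of $x^{(i)}_j$ in $\mathbf x^\mu$ is the number of occurrences of $j^{i-1}$ in $\mu$. **Tableaux.** Let $\mathrm{SYT}^r(n)$ be the set of $r$-tuples $\boldsymbol T=(T^{(1)},\dots,T^{(r)})$ of fillings of partition shapes (possibly empty, English notation), increasing along rows and down columns, in which each of $1,\dots,n$ appears exactly once in total and nothing else appears. A number $1\le i\le n-1$ is a descent of $\boldsymbol T$ if $i+1$ lies in a component strictly to the right of the one containing $i$, or in the same component in a row below $i$. Let $\mathrm{Des}(\boldsymbol T)$ be the set of descents, $\mathrm{des}(\boldsymbol T)$ its cardinality, and $\mathrm{maj}(\boldsymbol T)=r\sum_{i\in\mathrm{Des}(\boldsymbol T)}i+\sum_{j=1}^r(j-1)|T^{(j)}|$. **Proposition.** The coefficients of $\boldsymbol M_{n,k}(\mathbf x;q)$ as a polynomial in $q$ lie in $\Lambda^r(\mathbf x)$ (so that $\boldsymbol D_{n,k}$ is well defined), and $$\boldsymbol D_{n,k}(\mathbf x;q)=\mathrm{rev}_q\Bigg[\sum_{\boldsymbol T\in\mathrm{SYT}^r(n)}q^{\mathrm{maj}(\boldsymbol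 T)+r\binom{n-k}{2}-r(n-k)\mathrm{des}(\boldsymbol T)}\begin{bmatrix}\mathrm{des}(\boldsymbol T)\\ n-k\end{bmatrix}_{q^r}\boldsymbol s_{\mathrm{shape}(\boldsymbol T)'}(\mathbf x)\Bigg],$$ where $\begin{bmatrix}m\\a\end{bmatrix}_q=\frac{[m]!_q}{[a]!_q[m-a]!_q}$ is the $q$-binomial coefficient, equal to $0$ if $a>m$. In particular $\boldsymbol D_{n,k}(\mathbf x;q)$ is Schur positive: it is a finite linear combination of the $\boldsymbol s_{\boldsymbol\lambda}(\mathbf x)$ with coefficients in $\mathbb Z_{\ge0}[q]$. -/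

import Mathlib

open Polynomial

noncomputable section

/-- The alphabet of `r`-coloured letters, with the order that weights colours more heavily than
letter values, higher colours being smaller:
`1^{r-1} < 2^{r-1} < ⋯ < 1^{r-2} < 2^{r-2} < ⋯ < 1^0 < 2^0 < ⋯`.
It is the lexicographic order on pairs (colour, value) with the colours reversed.  Values are
indexed from `0`, so that the value `j : ℕ` stands for the positive integer `j + 1`. -/
abbrev ColoredLetter (r : ℕ) : Type := (Fin r)ᵒᵈ ×ₗ ℕ

/-- The colour `c ∈ {0, …, r-1}` of a coloured letter. -/
def ColoredLetter.color {r : ℕ} (a : ColoredLetter r) : Fin r := OrderDual.ofDual (ofLex a).1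

/-- The (zero-based) value of a coloured letter. -/
def ColoredLetter.value {r : ℕ} (a : ColoredLetter r) : ℕ := (ofLex a).2

/-- The index set of the variables `x^{(i)}_j`: the pair `(i, j)`, both entries counted from `0`,
stands for `x^{(i+1)}_{j+1}`. -/
abbrev VarIndex (r : ℕ) : Type := Fin r × ℕ

/-- An `r`-coloured ordered multiset partition of size `n` with `k` blocks: a sequence of `k`
finite nonempty sets of coloured letters whose cardinalities add up to `n`. -/
structure ColoredOMP (r n k : ℕ) where
  block : Fin k → Finset (ColoredLetter r)
  nonempty : ∀ i, (block i).Nonempty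
  size : ∑ i, (block i).card = n

/-- Descent set of a word `w = w_1 … w_m` of coloured letters: the set of those `1 ≤ i ≤ m - 1`
with `w_i > w_{i+1}`.  (The letter `w_i` is the list entry with index `i - 1`.) -/
def wordDes {r : ℕ} (w : List (ColoredLetter r)) : Finset ℕ := by
  classical
  exact (Finset.Ico 1 w.length).filter
    (fun i => ∃ a b, w[i - 1]? = some a ∧ w[i]? = some b ∧ b < a)

namespace ColoredOMP

variable {r n k : ℕ}

/-- The word underlying the descent starred notation: the blocks are concatenated, each of them
written in decreasing order. -/
def word (μ : ColoredOMP r n k) : List (ColoredLetter r) :=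
  (List.ofFn (fun i => (μ.block i).sort (fun a b => b ≤ a))).flatten

/-- The set `S` of starred positions: those `1 ≤ i ≤ n - 1` for which the `i`-th and the
`(i+1)`-st letters of the word are in the same block, which means that `i` is not the total size
of the first `j` blocks for any `j`. -/
def stars (μ : ColoredOMP r n k) : Finset ℕ := by
  classical
  exact (Finset.Ico 1 n).filter
    (fun i => ∀ j : ℕ, j ≤ k →
      i ≠ ∑ t ∈ Finset.univ.filter (fun t : Fin k => t.val < j), (μ.block t).card)

/-- The sum of the colours of all letters. -/
def colorSum (μ : ColoredOMP r n k) : ℕ := ∑ i, ∑ a ∈ μ.block i, (a.color : ℕ)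

/-- The major index
`c(μ) + r * (∑_{i ∈ Des w} i - ∑_{i ∈ S} |Des w ∩ {i, i+1, …, n}|)`, where `(w, S)` is the descent
starred representation of `μ`.  The subtraction never truncates: as `S ⊆ Des w`, the second sum is
at most `1 + 2 + ⋯ + |Des w|`, which is at most the first. -/
def maj (μ : ColoredOMP r n k) : ℕ :=
  μ.colorSum +
    r * (∑ i ∈ wordDes μ.word, i -
      ∑ i ∈ μ.stars, ((wordDes μ.word).filter (fun d => i ≤ d)).card)

/-- The exponent vector of `x^μ`: the exponent of `x^{(i)}_j` is the number of occurrences of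
`j^{i-1}` in `μ`. -/
def weight (μ : ColoredOMP r n k) : VarIndex r →₀ ℕ :=
  ∑ i, ∑ a ∈ μ.block i, Finsupp.single (a.color, a.value) 1

end ColoredOMP

/-- The coefficient of `q^d` in `M_{n,k}(x;q) = ∑_μ q^{maj μ} x^μ`: the formal power series in
which the coefficient of the monomial `x^m` is the (finite) number of `r`-coloured ordered multiset
partitions `μ` of size `n` with `k` blocks such that `maj μ = d` and `x^μ = x^m`. -/
def MCoeff (r n k d : ℕ) : MvPowerSeries (VarIndex r) ℚ :=
  fun m => (Nat.card {μ : ColoredOMP r n k // μ.maj = d ∧ μ.weight = m} : ℚ)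

/-- `M_{n,k}(x;q)`, as a polynomial in `q` whose coefficients are power series in `x`.  Only
finitely many terms are nonzero, as `maj μ ≤ n * r + r * n ^ 2`. -/
def MSeries (r n k : ℕ) : (MvPowerSeries (VarIndex r) ℚ)[X] :=
  ∑ᶠ d : ℕ, monomial d (MCoeff r n k d)

/-- `Λ^r(x)`: the formal power series of bounded degree that are symmetric in each of the `r`
variable sets `x^{(1)}, …, x^{(r)}` separately. -/
def SymmR (r : ℕ) : Submodule ℚ (MvPowerSeries (VarIndex r) ℚ) where
  carrier := {F |
    (∃ N : ℕ, ∀ m : VarIndex r →₀ ℕ, MvPowerSeries.coeff m F ≠ 0 → m.degree ≤ N) ∧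
    ∀ (g : Fin r → Equiv.Perm ℕ) (m : VarIndex r →₀ ℕ),
      MvPowerSeries.coeff (m.mapDomain (fun p => (p.1, g p.1 p.2))) F = MvPowerSeries.coeff m F}
  zero_mem' := ⟨⟨0, fun m h => absurd (by simp) h⟩, fun g m => by simp⟩
  add_mem' := by
    rintro F G ⟨⟨N, hN⟩, hF⟩ ⟨⟨N', hN'⟩, hG⟩
    refine ⟨⟨max N N', fun m h => ?_⟩, fun g m => by simp [hF g m, hG g m]⟩
    by_cases h1 : MvPowerSeries.coeff m F = 0
    · refine (hN' m fun h2 => h (by simp [h1, h2])).trans (le_max_right _ _)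
    · exact (hN m h1).trans (le_max_left _ _)
  smul_mem' := by
    rintro c F ⟨⟨N, hN⟩, hF⟩
    refine ⟨⟨N, fun m h => hN m fun h1 => h (by simp [h1])⟩, fun g m => by simp [hF g m]⟩

/-- The exponent vector of `x^T` for a semistandard `r`-tableau `T`: the exponent of `x^{(i)}_j` is
the multiplicity of `j` in `T^{(i)}` (both counted from `0`). -/
def tableauWeight {r : ℕ} {lam : Fin r → YoungDiagram}
    (T : ∀ i, SemistandardYoungTableau (lam i)) : VarIndex r →₀ ℕ :=
  ∑ i, ∑ c ∈ (lam i).cells, Finsupp.single (i, T i c.1 c.2) 1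

/-- The Schur function `s_λ(x) = s_{λ^{(1)}}(x^{(1)}) ⋯ s_{λ^{(r)}}(x^{(r)}) = ∑_T x^T` of an
`r`-partition `λ`, the sum being over all semistandard `r`-tableaux of shape `λ`. -/
def schur {r : ℕ} (lam : Fin r → YoungDiagram) : MvPowerSeries (VarIndex r) ℚ :=
  fun m => (Nat.card
    {T : ∀ i, SemistandardYoungTableau (lam i) // tableauWeight T = m} : ℚ)

/-- The componentwise conjugate of an `r`-partition. -/
def conj {r : ℕ} (lam : Fin r → YoungDiagram) : Fin r → YoungDiagram :=
  fun i => (lam i).transpose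

/-- The defining property of the involution `ω`: it sends `s_λ` to `s_{λ'}` for all
`r`-partitions `λ`. -/
def IsOmega (r : ℕ) (w : SymmR r →ₗ[ℚ] SymmR r) : Prop :=
  ∀ lam : Fin r → YoungDiagram,
    ∃ h : schur lam ∈ SymmR r, (w ⟨schur lam, h⟩ : MvPowerSeries (VarIndex r) ℚ) = schur (conj lam)

open Classical in
/-- The linear map `ω : Λ^r(x) → Λ^r(x)` which sends `s_λ` to `s_{λ'}` for all `r`-partitions `λ`.
(It exists and is unique because the Schur functions are a basis of `Λ^r(x)`.) -/
def omega (r : ℕ) : SymmR r →ₗ[ℚ] SymmR r :=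
  if h : ∃ w, IsOmega r w then h.choose else 0

open Classical in
/-- `ω` on power series; the value outside `Λ^r(x)` is irrelevant. -/
def omegaSeries (r : ℕ) (F : MvPowerSeries (VarIndex r) ℚ) : MvPowerSeries (VarIndex r) ℚ :=
  if h : F ∈ SymmR r then (omega r ⟨F, h⟩ : MvPowerSeries (VarIndex r) ℚ) else 0

/-- `ω` on polynomials in `q`, coefficient by coefficient (`ω` is linear over scalars in `q`). -/
def omegaQ (r : ℕ) (P : (MvPowerSeries (VarIndex r) ℚ)[X]) : (MvPowerSeries (VarIndex r) ℚ)[X] :=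
  ∑ d ∈ P.support, monomial d (omegaSeries r (P.coeff d))

/-- The operator which reverses the coefficient sequence of a polynomial in `q`,
`P(q) ↦ q^{deg P} P(q⁻¹)`. -/
def revQ {R : Type*} [Semiring R] (P : R[X]) : R[X] := P.reverse

/-- `D_{n,k}(x;q) = (rev_q ∘ ω) M_{n,k}(x;q)`. -/
def DSeries (r n k : ℕ) : (MvPowerSeries (VarIndex r) ℚ)[X] :=
  revQ (omegaQ r (MSeries r n k))

/-- The cells of an `r`-tuple of Young diagrams, as triples (component, row, column). -/
def rCells {r : ℕ} (lam : Fin r → YoungDiagram) : Set (Fin r × ℕ × ℕ) :=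
  {p | p.2 ∈ lam p.1}

/-- `SYT^r(n)`: standard tableaux with `r` components and `n` boxes, i.e. semistandard
`r`-tableaux in which each of the entries `1, …, n` appears precisely once and nothing else
appears. -/
structure StdRTableau (r n : ℕ) where
  shape : Fin r → YoungDiagram
  tab : ∀ i, SemistandardYoungTableau (shape i)
  standard : Set.BijOn (fun p : Fin r × ℕ × ℕ => tab p.1 p.2.1 p.2.2) (rCells shape) (Set.Icc 1 n)

namespace StdRTableau

variable {r n : ℕ}

/-- `i ∈ {1, …, n - 1}` is a descent if `i + 1` lies in a component strictly to the right of the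
component of `i`, or in the same component and in a row below that of `i`. -/
def Des (T : StdRTableau r n) : Finset ℕ := by
  classical
  exact (Finset.Ico 1 n).filter
    (fun i => ∃ p ∈ rCells T.shape, ∃ p' ∈ rCells T.shape,
      T.tab p.1 p.2.1 p.2.2 = i ∧ T.tab p'.1 p'.2.1 p'.2.2 = i + 1 ∧
        (p.1 < p'.1 ∨ (p.1 = p'.1 ∧ p.2.1 < p'.2.1)))

/-- The number of descents. -/
def des (T : StdRTableau r n) : ℕ := T.Des.card

/-- The major index `r * ∑_{i ∈ Des T} i + ∑_j (j - 1) |T^{(j)}|` (here `j` counts from `0`). -/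
def maj (T : StdRTableau r n) : ℕ :=
  r * ∑ i ∈ T.Des, i + ∑ j : Fin r, (j : ℕ) * (T.shape j).card

theorem cell_lt (T : StdRTableau r n) {i : Fin r} {a b : ℕ} (h : (a, b) ∈ T.shape i) :
    a < n ∧ b < n := by
  have key : ∀ (m : ℕ) (f : ℕ → ℕ × ℕ), Function.Injective f →
      (∀ x ≤ m, f x ∈ T.shape i) → m < n := by
    intro m f hf hm
    have h1 : (Finset.range (m + 1)).card ≤ (Finset.Icc 1 n).card := by
      refine Finset.card_le_card_of_injOn (fun x => T.tab i (f x).1 (f x).2) ?_ ?_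
      · intro x hx
        have hx' : f x ∈ T.shape i := hm x (by simpa [Nat.lt_succ_iff] using hx)
        have := T.standard.mapsTo (show ((i, f x) : Fin r × ℕ × ℕ) ∈ rCells T.shape from hx')
        simpa using this
      · intro x hx y hy hxy
        have hx' : f x ∈ T.shape i := hm x (by simpa [Nat.lt_succ_iff] using hx)
        have hy' : f y ∈ T.shape i := hm y (by simpa [Nat.lt_succ_iff] using hy)
        have := T.standard.injOn (show ((i, f x) : Fin r × ℕ × ℕ) ∈ rCells T.shape from hx')
          (show ((i, f y) : Fin r × ℕ × ℕ) ∈ rCells T.shape from hy') hxy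
        exact hf (Prod.ext_iff.1 this).2
    simp at h1
    omega
  constructor
  · exact key a (fun x => (x, b)) (fun x y hxy => (Prod.ext_iff.1 hxy).1)
      (fun x hx => (T.shape i).up_left_mem hx le_rfl h)
  · exact key b (fun x => (a, x)) (fun x y hxy => (Prod.ext_iff.1 hxy).2)
      (fun x hx => (T.shape i).up_left_mem le_rfl hx h)

/-- `SYT^r(n)` is a finite set. -/
instance finite_stdRTableau (r n : ℕ) : Finite (StdRTableau r n) := by
  let Φ : StdRTableau r n → Set (Fin r × Fin n × Fin n × Fin (n + 1)) := fun T =>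
    {p | ((p.2.1 : ℕ), (p.2.2.1 : ℕ)) ∈ T.shape p.1 ∧ T.tab p.1 p.2.1 p.2.2.1 = p.2.2.2}
  refine Finite.of_injective Φ ?_
  have sub : ∀ T T' : StdRTableau r n, Φ T = Φ T' → ∀ (i : Fin r) (a b : ℕ),
      (a, b) ∈ T.shape i → (a, b) ∈ T'.shape i ∧ T.tab i a b = T'.tab i a b := by
    intro T T' hT i a b hab
    obtain ⟨ha, hb⟩ := T.cell_lt hab
    have hv := T.standard.mapsTo (show ((i, (a, b)) : Fin r × ℕ × ℕ) ∈ rCells T.shape from hab)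
    have hv' : T.tab i a b < n + 1 := Nat.lt_succ_of_le hv.2
    have hmem : ((i, ⟨a, ha⟩, ⟨b, hb⟩, ⟨T.tab i a b, hv'⟩) :
        Fin r × Fin n × Fin n × Fin (n + 1)) ∈ Φ T := ⟨hab, rfl⟩
    rw [hT] at hmem
    exact ⟨hmem.1, hmem.2.symm⟩
  intro T T' hT
  have hs : T.shape = T'.shape := by
    funext i
    ext ⟨a, b⟩
    exact ⟨fun h => (sub T T' hT i a b h).1, fun h => (sub T' T hT.symm i a b h).1⟩
  have ht : ∀ i a b, T.tab i a b = T'.tab i a b := by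
    intro i a b
    by_cases h : (a, b) ∈ T.shape i
    · exact (sub T T' hT i a b h).2
    · have h' : (a, b) ∉ T'.shape i := by rwa [← hs]
      rw [(T.tab i).zeros h, (T'.tab i).zeros h']
  obtain ⟨s, t, h⟩ := T
  obtain ⟨s', t', h'⟩ := T'
  obtain rfl : s = s' := hs
  obtain rfl : t = t' := by
    funext i
    exact SemistandardYoungTableau.ext (ht i)
  rfl

end StdRTableau

/-- The `q`-integer `[m]_q = 1 + q + ⋯ + q^{m-1}`. -/
def qInt (m : ℕ) : ℚ[X] := ∑ i ∈ Finset.range m, X ^ i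

/-- The `q`-factorial `[m]!_q = [m]_q ⋯ [1]_q`. -/
def qFact (m : ℕ) : ℚ[X] := ∏ i ∈ Finset.range m, qInt (i + 1)

/-- The `q`-binomial coefficient `[m]!_q / ([a]!_q [m-a]!_q)` (the division of polynomials is
exact), which is `0` for `a > m`. -/
def qBinom (m a : ℕ) : ℚ[X] := if a ≤ m then qFact m / (qFact a * qFact (m - a)) else 0

/-- The polynomial `q^{maj T + r * C(n-k,2) - r (n-k) des T} [des T choose n-k]_{q^r}`.  The
subtraction in the exponent never truncates, as `maj T ≥ r * (1 + 2 + ⋯ + des T)`. -/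
def tableauPoly {r n : ℕ} (k : ℕ) (T : StdRTableau r n) : ℚ[X] :=
  X ^ (T.maj + r * (n - k).choose 2 - r * (n - k) * T.des) * (qBinom T.des (n - k)).comp (X ^ r)

/-- The polynomial `∑_{T ∈ SYT^r(n)} q^{…} [des T choose n-k]_{q^r} s_{shape(T)'}(x)` in `q`;
`SYT^r(n)` is a finite set. -/
def tableauSum (r n k : ℕ) : (MvPowerSeries (VarIndex r) ℚ)[X] :=
  ∑ᶠ T : StdRTableau r n,
    (tableauPoly k T).map (algebraMap ℚ (MvPowerSeries (VarIndex r) ℚ)) * C (schur (conj T.shape))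

/-- Schur positivity of a polynomial in `q` over power series: it is a linear combination of
finitely many Schur functions with coefficients in `ℤ_{≥ 0}[q]`. -/
def SchurPositive {r : ℕ} (P : (MvPowerSeries (VarIndex r) ℚ)[X]) : Prop :=
  ∃ c : (Fin r → YoungDiagram) →₀ ℕ[X],
    P = c.sum (fun lam p => p.map (Nat.castRingHom (MvPowerSeries (VarIndex r) ℚ)) * C (schur lam))

end

/-! An ordered multiset partition amounts to a pair (w, S), where w is its word and S is a set of n
- k descents of w: cutting w at the positions outside S gives back the blocks
(`ColoredOMP.exists_word_stars`, `ColoredOMP.eq_of_word_stars`). The colour sum depends only on the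
monomial. For fixed w the sum over S depends only on Des(w), and ranking the descents as 0, 1, …, l
- 1 turns it into a sum of powers of q^r over the (n - k)-subsets of {0, …, l - 1}, that is, into a
q-binomial coefficient times a power of q (`sum_powersetCard_eq_gaussPoly`).

So the coefficient of a monomial x^m is the sum, over the words of content m, of a polynomial
depending only on the descent set. It remains to see that the words of content m with descent set E
are counted by the coefficient of x^m in the sum of s_shape(T) over the standard r-tableaux T with
Des(T) = E (`StdRTableau.sum_words_eq_sum_tableaux`). This is the counting content of the
Robinson–Schensted–Knuth correspondence, obtained here by matching recursions, without insertion. By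
inclusion–exclusion, descent sets contained in a given D suffice. Let p be the last element of D
below the length, or 0. After position p such a word is weakly increasing, hence determined by its
first p letters and its content. A standard tableau, encoded as a Yamanouchi word of row letters,
splits at p in the same way, and the part after p fills a horizontal strip in each component.
Pieri's rule turns one recursion into the other (`wordCount_eq_sum_yamanouchiCount`).

Pieri's rule, in its form for Kostka numbers, follows by induction on the largest entry from a
bijection between common upper and common lower horizontal strips of two diagrams
(`YoungDiagram.card_commonStrips`). A second bijection of this kind makes Schur functions symmetric.
Their linear independence makes ω well defined, and ω conjugates the shapes in the expansion.
Reversal in q only moves coefficients, so positivity is inherited from the q-binomials. -/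

namespace YoungDiagram

/-! ### Horizontal strips and bijections between them -/

/-- The Young diagram with row lengths `f 0, …, f (N - 1)`, for antitone `f`. -/
def ofRows (N : ℕ) (f : ℕ → ℕ) : YoungDiagram where
  cells := (Finset.range N ×ˢ Finset.range (f 0)).filter (fun c => ∀ i ≤ c.1, c.2 < f i)
  isLowerSet := by
    rintro ⟨a, b⟩ ⟨a', b'⟩ ⟨h1, h2⟩ h
    simp only [Finset.coe_filter, Finset.mem_product, Finset.mem_range, Set.mem_ofPred_eq] at h ⊢
    simp only at h1 h2
    exact ⟨⟨by omega, by omega⟩, fun i hi => lt_of_le_of_lt h2 (h.2 i (by omega))⟩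

theorem rowLen_ofRows {N : ℕ} {f : ℕ → ℕ} (hf : Antitone f) (hN : f N = 0) (i : ℕ) :
    (ofRows N f).rowLen i = f i := by
  refine eq_of_forall_lt_iff fun j => ?_
  rw [← mem_iff_lt_rowLen]
  change (i, j) ∈ Finset.filter _ _ ↔ _
  simp only [Finset.mem_filter, Finset.mem_product, Finset.mem_range]
  constructor
  · exact fun h => h.2 i le_rfl
  · intro h
    refine ⟨⟨?_, h.trans_le (hf (Nat.zero_le i))⟩, fun i' hi' => h.trans_le (hf hi')⟩
    by_contra hc
    have := hf (not_lt.1 hc)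
    omega

theorem ext_rowLen {μ ν : YoungDiagram} (h : ∀ i, μ.rowLen i = ν.rowLen i) : μ = ν := by
  ext ⟨i, j⟩
  rw [mem_cells, mem_cells, mem_iff_lt_rowLen, mem_iff_lt_rowLen, h]

theorem rowLen_le_card (μ : YoungDiagram) (i : ℕ) : μ.rowLen i ≤ μ.card := by
  rw [rowLen_eq_card]
  exact Finset.card_le_card (Finset.filter_subset _ _)

theorem colLen_le_card (μ : YoungDiagram) (i : ℕ) : μ.colLen i ≤ μ.card := by
  rw [colLen_eq_card]
  exact Finset.card_le_card (Finset.filter_subset _ _)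

theorem rowLen_eq_zero {μ : YoungDiagram} {N : ℕ} (h : μ.card ≤ N) : μ.rowLen N = 0 := by
  by_contra hc
  have h1 : (N, 0) ∈ μ := mem_iff_lt_rowLen.2 (Nat.pos_of_ne_zero hc)
  rw [mem_iff_lt_colLen] at h1
  have := μ.colLen_le_card 0
  omega

theorem card_eq_sum_rowLen {μ : YoungDiagram} {N : ℕ} (h : μ.rowLen N = 0) :
    μ.card = ∑ i ∈ Finset.range N, μ.rowLen i := by
  simp only [rowLen_eq_card]
  refine Finset.card_eq_sum_card_fiberwise (f := Prod.fst) ?_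
  rintro ⟨i, j⟩ hc
  rw [Finset.mem_coe, mem_cells, mem_iff_lt_rowLen] at hc
  by_contra hi
  simp only [Finset.coe_range, Set.mem_Iio, not_lt] at hi
  have := μ.rowLen_anti _ _ hi
  omega

theorem finite_card_le (M : ℕ) : {μ : YoungDiagram | μ.card ≤ M}.Finite := by
  refine Set.Finite.of_finite_image (f := YoungDiagram.cells) ?_ (fun μ _ ν _ h => YoungDiagram.ext h)
  refine ((Finset.range M ×ˢ Finset.range M).powerset.finite_toSet).subset ?_
  rintro _ ⟨μ, hμ, rfl⟩
  simp only [Finset.coe_powerset, Set.mem_preimage, Set.mem_powerset_iff, Finset.coe_subset]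
  rintro ⟨i, j⟩ hc
  simp only [Finset.mem_product, Finset.mem_range]
  have hμ' : μ.card ≤ M := hμ
  rw [mem_cells] at hc
  exact ⟨((mem_iff_lt_colLen.1 hc).trans_le (μ.colLen_le_card j)).trans_le hμ',
    ((mem_iff_lt_rowLen.1 hc).trans_le (μ.rowLen_le_card i)).trans_le hμ'⟩

/-- The finset of Young diagrams with at most `M` cells. -/
noncomputable def cardLE (M : ℕ) : Finset YoungDiagram := (finite_card_le M).toFinset

theorem mem_cardLE {M : ℕ} {μ : YoungDiagram} : μ ∈ cardLE M ↔ μ.card ≤ M := by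
  simp [cardLE]

/-- `ν ⊆ μ`, and `μ / ν` has at most one cell in each column. -/
def IsHStrip (ν μ : YoungDiagram) : Prop :=
  ∀ i, μ.rowLen (i + 1) ≤ ν.rowLen i ∧ ν.rowLen i ≤ μ.rowLen i

theorem IsHStrip.le {ν μ : YoungDiagram} (h : IsHStrip ν μ) : ν ≤ μ := by
  rintro ⟨i, j⟩ hc
  exact mem_iff_lt_rowLen.2 ((mem_iff_lt_rowLen.1 hc).trans_le (h i).2)

theorem card_mono {ν μ : YoungDiagram} (h : ν ≤ μ) : ν.card ≤ μ.card :=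
  Finset.card_le_card (cells_subset_iff.2 h)

theorem IsHStrip.card_le {ν μ : YoungDiagram} (h : IsHStrip ν μ) : ν.card ≤ μ.card :=
  card_mono h.le

theorem IsHStrip.mem_of_lt {ν μ : YoungDiagram} (h : IsHStrip ν μ) {i i' j : ℕ} (hi : i < i')
    (hc : (i', j) ∈ μ) : (i, j) ∈ ν := by
  rw [mem_iff_lt_rowLen] at hc ⊢
  exact (hc.trans_le (μ.rowLen_anti (i + 1) i' hi)).trans_le (h i).1

-- This is the local growth rule behind RSK. Strip conditions are interlacing inequalities on row
-- lengths: row i + 1 of a common upper diagram μ and row i of a common lower diagram τ range over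
-- the same interval, from max(ν_{i+1}, κ_{i+1}) to min(ν_i, κ_i), and reflecting this interval
-- exchanges them. Row 0 of μ is only bounded below, by max(ν_0, κ_0); its excess is |τ| + b - |ν|,
-- so that |ν| ≤ |τ| + b is exactly the condition that the excess is nonnegative.
open Classical in
theorem card_commonStrips {ν κ : YoungDiagram} {b M M' : ℕ} (hM : κ.card + b ≤ M)
    (hν : ν.card ≤ M') :
    ((cardLE M).filter fun μ => IsHStrip ν μ ∧ IsHStrip κ μ ∧ μ.card = κ.card + b).card =
      ((cardLE M').filter fun τ => IsHStrip τ ν ∧ IsHStrip τ κ ∧ ν.card ≤ τ.card + b).card := by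
  set N := ν.card + κ.card + b + 1 with hN
  -- Row lengths of the two inverse maps: reflection in the interval of each row, with a shift of
  -- the row index by one.
  let down : YoungDiagram → ℕ → ℕ := fun μ i =>
    min (ν.rowLen i) (κ.rowLen i) + max (ν.rowLen (i + 1)) (κ.rowLen (i + 1)) - μ.rowLen (i + 1)
  let up : YoungDiagram → ℕ → ℕ := fun τ i => match i with
    | 0 => max (ν.rowLen 0) (κ.rowLen 0) + (b + τ.card - ν.card)
    | i + 1 =>
      min (ν.rowLen i) (κ.rowLen i) + max (ν.rowLen (i + 1)) (κ.rowLen (i + 1)) - τ.rowLen i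
  have hνz : ∀ i, N ≤ i + 1 → ν.rowLen i = 0 := fun i hi => rowLen_eq_zero (by omega)
  have hκz : ∀ i, N ≤ i + 1 → κ.rowLen i = 0 := fun i hi => rowLen_eq_zero (by omega)
  have anti_down : ∀ μ, IsHStrip ν μ → IsHStrip κ μ → Antitone (down μ) := by
    intro μ h1 h2
    refine antitone_nat_of_succ_le fun i => ?_
    have a1 := h1 (i + 1); have a2 := h2 (i + 1); have a3 := h1 (i + 1 + 1); have a4 := h2 (i + 1 + 1)
    have a5 := h1 i; have a6 := h2 i
    simp only [down]
    omega
  have anti_up : ∀ τ, IsHStrip τ ν → IsHStrip τ κ → Antitone (up τ) := by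
    intro τ h1 h2
    refine antitone_nat_of_succ_le fun i => ?_
    cases i with
    | zero =>
      have a1 := h1 0; have a2 := h2 0
      simp only [up]
      omega
    | succ i =>
      have a1 := h1 (i + 1); have a2 := h2 (i + 1)
      have a5 := h1 i; have a6 := h2 i
      simp only [up]
      omega
  have row_down : ∀ μ, IsHStrip ν μ → IsHStrip κ μ → ∀ i, (ofRows N (down μ)).rowLen i = down μ i := by
    intro μ h1 h2
    refine rowLen_ofRows (anti_down μ h1 h2) ?_
    have a1 := hνz N (by omega); have a2 := hνz (N + 1) (by omega)
    have a3 := hκz N (by omega); have a4 := hκz (N + 1) (by omega)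
    simp only [down]
    omega
  have row_up : ∀ τ, IsHStrip τ ν → IsHStrip τ κ → ∀ i, (ofRows N (up τ)).rowLen i = up τ i := by
    intro τ h1 h2
    refine rowLen_ofRows (anti_up τ h1 h2) ?_
    have a1 := hνz (N - 1) (by omega); have a2 := hνz N (by omega)
    have a3 := hκz (N - 1) (by omega); have a4 := hκz N (by omega)
    rw [show N = (N - 1) + 1 by omega] at a2 a4 ⊢
    simp only [up]
    omega
  -- Size bookkeeping: min and max of the same row add up to ν_i + κ_i. Regrouping the sum by rows
  -- leaves only the max of row 0 unmatched, and the last min is zero.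
  have key : ∀ (x : ℕ → ℕ) (y : ℕ → ℕ), (∀ i, x (i + 1) + y i =
      min (ν.rowLen i) (κ.rowLen i) + max (ν.rowLen (i + 1)) (κ.rowLen (i + 1))) →
      (∑ i ∈ Finset.range N, x i) + (∑ i ∈ Finset.range (N - 1), y i) +
        max (ν.rowLen 0) (κ.rowLen 0) = ν.card + κ.card + x 0 := by
    intro x y hxy
    have h : ∀ n, (∑ i ∈ Finset.range (n + 1), x i) + (∑ i ∈ Finset.range n, y i) +
        max (ν.rowLen 0) (κ.rowLen 0) + min (ν.rowLen n) (κ.rowLen n) =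
        ∑ i ∈ Finset.range (n + 1), ν.rowLen i + ∑ i ∈ Finset.range (n + 1), κ.rowLen i + x 0 := by
      intro n
      induction n with
      | zero => simp; omega
      | succ n ih =>
        have := hxy n
        rw [Finset.sum_range_succ, Finset.sum_range_succ y, Finset.sum_range_succ ν.rowLen,
          Finset.sum_range_succ κ.rowLen]
        omega
    have := h (N - 1)
    rw [show N - 1 + 1 = N by omega, ← card_eq_sum_rowLen (hνz N (by omega)),
      ← card_eq_sum_rowLen (hκz N (by omega)), hνz (N - 1) (by omega), Nat.zero_min] at this
    exact this
  have sum_down : ∀ μ, IsHStrip ν μ → IsHStrip κ μ → μ.card = κ.card + b →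
      (ofRows N (down μ)).card + b + max (ν.rowLen 0) (κ.rowLen 0) = ν.card + μ.rowLen 0 := by
    intro μ h1 h2 h3
    have z1 : μ.rowLen N = 0 := rowLen_eq_zero (by omega)
    have z2 : (ofRows N (down μ)).rowLen (N - 1) = 0 := by
      rw [row_down μ h1 h2]
      have a1 := hνz (N - 1) (by omega); have a2 := hνz (N - 1 + 1) (by omega)
      have a3 := hκz (N - 1) (by omega); have a4 := hκz (N - 1 + 1) (by omega)
      simp only [down]
      omega
    have := key μ.rowLen (ofRows N (down μ)).rowLen (fun i => by
      rw [row_down μ h1 h2]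
      have a1 := h1 i; have a2 := h2 i; have a3 := h1 (i + 1); have a4 := h2 (i + 1)
      simp only [down]
      omega)
    rw [← card_eq_sum_rowLen z1, ← card_eq_sum_rowLen z2] at this
    omega
  have sum_up : ∀ τ, IsHStrip τ ν → IsHStrip τ κ → ν.card ≤ τ.card + b →
      (ofRows N (up τ)).card = κ.card + b := by
    intro τ h1 h2 h3
    have hτ := h1.card_le
    have z1 : (ofRows N (up τ)).rowLen N = 0 := by
      rw [row_up τ h1 h2]
      have a1 := hνz (N - 1) (by omega); have a2 := hνz N (by omega)
      have a3 := hκz (N - 1) (by omega); have a4 := hκz N (by omega)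
      rw [show N = (N - 1) + 1 by omega] at a2 a4 ⊢
      simp only [up]
      omega
    have z2 : τ.rowLen (N - 1) = 0 := rowLen_eq_zero (by omega)
    have := key (ofRows N (up τ)).rowLen τ.rowLen (fun i => by
      rw [row_up τ h1 h2]
      have a1 := h1 i; have a2 := h2 i
      simp only [up]
      omega)
    rw [← card_eq_sum_rowLen z1, ← card_eq_sum_rowLen z2, row_up τ h1 h2] at this
    have e0 : up τ 0 = max (ν.rowLen 0) (κ.rowLen 0) + (b + τ.card - ν.card) := rfl
    rw [e0] at this
    omega
  refine Finset.card_nbij' (fun μ => ofRows N (down μ)) (fun τ => ofRows N (up τ)) ?_ ?_ ?_ ?_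
  · intro μ hμ
    simp only [Finset.coe_filter, Set.mem_ofPred_eq, mem_cardLE] at hμ ⊢
    obtain ⟨_, h1, h2, h3⟩ := hμ
    have hs := sum_down μ h1 h2 h3
    have b1 := h1 0; have b2 := h2 0
    have H1 : IsHStrip (ofRows N (down μ)) ν := by
      intro i
      rw [row_down μ h1 h2]
      have a1 := h1 i; have a2 := h2 i; have a3 := h1 (i + 1); have a4 := h2 (i + 1)
      simp only [down]
      omega
    refine ⟨H1.card_le.trans hν, H1, ?_, by omega⟩
    intro i
    rw [row_down μ h1 h2]
    have a1 := h1 i; have a2 := h2 i; have a3 := h1 (i + 1); have a4 := h2 (i + 1)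
    simp only [down]
    omega
  · intro τ hτ
    simp only [Finset.coe_filter, Set.mem_ofPred_eq, mem_cardLE] at hτ ⊢
    obtain ⟨_, h1, h2, h3⟩ := hτ
    have hs := sum_up τ h1 h2 h3
    refine ⟨by omega, ?_, ?_, hs⟩ <;>
    · intro i
      rw [row_up τ h1 h2, row_up τ h1 h2]
      cases i with
      | zero =>
        have a1 := h1 0; have a2 := h2 0
        simp only [up]
        omega
      | succ i =>
        have a1 := h1 i; have a2 := h2 i; have a3 := h1 (i + 1); have a4 := h2 (i + 1)
        simp only [up]
        omega
  · intro μ hμ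
    simp only [Finset.coe_filter, Set.mem_ofPred_eq, mem_cardLE] at hμ
    obtain ⟨_, h1, h2, h3⟩ := hμ
    have hs := sum_down μ h1 h2 h3
    have H1 : IsHStrip (ofRows N (down μ)) ν := by
      intro i
      rw [row_down μ h1 h2]
      have a1 := h1 i; have a2 := h2 i; have a3 := h1 (i + 1); have a4 := h2 (i + 1)
      simp only [down]
      omega
    have H2 : IsHStrip (ofRows N (down μ)) κ := by
      intro i
      rw [row_down μ h1 h2]
      have a1 := h1 i; have a2 := h2 i; have a3 := h1 (i + 1); have a4 := h2 (i + 1)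
      simp only [down]
      omega
    refine ext_rowLen fun i => ?_
    simp only
    rw [row_up _ H1 H2]
    cases i with
    | zero =>
      have a1 := h1 0; have a2 := h2 0
      simp only [up]
      omega
    | succ i =>
      have a1 := h1 i; have a2 := h2 i; have a3 := h1 (i + 1); have a4 := h2 (i + 1)
      simp only [up]
      rw [row_down μ h1 h2]
      simp only [down]
      omega
  · intro τ hτ
    simp only [Finset.coe_filter, Set.mem_ofPred_eq, mem_cardLE] at hτ
    obtain ⟨_, h1, h2, h3⟩ := hτ
    have H : ∀ i, (max (ν.rowLen i) (κ.rowLen i) ≤ up τ i) ∧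
        up τ (i + 1) ≤ min (ν.rowLen i) (κ.rowLen i) := by
      intro i
      cases i with
      | zero =>
        have a1 := h1 0; have a2 := h2 0
        simp only [up]
        omega
      | succ i =>
        have a1 := h1 i; have a2 := h2 i; have a3 := h1 (i + 1); have a4 := h2 (i + 1)
        simp only [up]
        omega
    have H1 : IsHStrip ν (ofRows N (up τ)) := fun i => by
      have := H i
      rw [row_up τ h1 h2, row_up τ h1 h2]
      omega
    have H2 : IsHStrip κ (ofRows N (up τ)) := fun i => by
      have := H i
      rw [row_up τ h1 h2, row_up τ h1 h2]
      omega
    refine ext_rowLen fun i => ?_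
    simp only
    rw [row_down _ H1 H2]
    simp only [down]
    rw [row_up τ h1 h2]
    have a1 := h1 i; have a2 := h2 i
    simp only [up]
    omega

-- This is the Bender–Knuth involution on shapes. Given μ and ξ, row i of the middle diagram ranges
-- independently over the interval from max(ξ_{i+1}, μ_i) to min(ξ_i, μ_{i-1}), with upper end ξ_0
-- for i = 0. Reflecting all these intervals replaces |ν| by |ξ| + |μ| - |ν|, which swaps the sizes
-- of the two strips. An injection suffices, as a and b are arbitrary.
open Classical in
theorem card_chains_le {μ ξ : YoungDiagram} {a b M : ℕ} (hM : ξ.card ≤ M) :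
    ((cardLE M).filter fun ν => IsHStrip μ ν ∧ IsHStrip ν ξ ∧
        ξ.card = ν.card + a ∧ ν.card = μ.card + b).card ≤
      ((cardLE M).filter fun ν => IsHStrip μ ν ∧ IsHStrip ν ξ ∧
        ξ.card = ν.card + b ∧ ν.card = μ.card + a).card := by
  set N := ξ.card + 1 with hN
  let tog : YoungDiagram → ℕ → ℕ := fun ν i => match i with
    | 0 => ξ.rowLen 0 + max (ξ.rowLen (0 + 1)) (μ.rowLen 0) - ν.rowLen 0
    | i + 1 => min (ξ.rowLen (i + 1)) (μ.rowLen i) +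
        max (ξ.rowLen (i + 1 + 1)) (μ.rowLen (i + 1)) - ν.rowLen (i + 1)
  have hξz : ∀ i, N ≤ i + 1 → ξ.rowLen i = 0 := fun i hi => rowLen_eq_zero (by omega)
  have bds : ∀ ν, IsHStrip μ ν → IsHStrip ν ξ → ∀ i, μ.rowLen i ≤ tog ν i ∧
      tog ν (i + 1) ≤ μ.rowLen i ∧ tog ν i ≤ ξ.rowLen i ∧ ξ.rowLen (i + 1) ≤ tog ν i := by
    intro ν h1 h2 i
    have a1 := h1 i; have a2 := h2 i; have a3 := h1 (i + 1); have a4 := h2 (i + 1)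
    cases i with
    | zero => simp only [tog, zero_add] at *; omega
    | succ i =>
      have a5 := h1 i; have a6 := h2 i
      simp only [tog] at *
      omega
  have row_tog : ∀ ν, IsHStrip μ ν → IsHStrip ν ξ → ∀ i, (ofRows N (tog ν)).rowLen i = tog ν i := by
    intro ν h1 h2
    refine rowLen_ofRows ?_ ?_
    · refine antitone_nat_of_succ_le fun i => ?_
      have := bds ν h1 h2 i
      omega
    · have := bds ν h1 h2 N
      have := hξz N (by omega)
      omega
  have sum_tog : ∀ ν, IsHStrip μ ν → IsHStrip ν ξ →
      (ofRows N (tog ν)).card + ν.card = ξ.card + μ.card := by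
    intro ν h1 h2
    have hν := h2.card_le
    have hμ := h1.card_le
    have z : (ofRows N (tog ν)).rowLen N = 0 := by
      rw [row_tog ν h1 h2]
      have := bds ν h1 h2 N
      have := hξz N (by omega)
      omega
    have e1 : ξ.card = ∑ i ∈ Finset.range (ξ.card + 1 + 1), ξ.rowLen i :=
      card_eq_sum_rowLen (rowLen_eq_zero (by omega))
    have e2 : μ.card = ∑ i ∈ Finset.range (ξ.card + 1), μ.rowLen i :=
      card_eq_sum_rowLen (rowLen_eq_zero (by omega))
    have e3 : ∀ n, ∑ i ∈ Finset.range (n + 1), (tog ν i + ν.rowLen i) +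
        min (ξ.rowLen (n + 1)) (μ.rowLen n)
        = ∑ i ∈ Finset.range (n + 1 + 1), ξ.rowLen i + ∑ i ∈ Finset.range (n + 1), μ.rowLen i := by
      intro n
      induction n with
      | zero =>
        have a1 := h1 0; have a2 := h2 0
        simp only [tog, Finset.sum_range_succ, Finset.sum_range_zero, zero_add]
        omega
      | succ n ih =>
        have a1 := h1 n; have a2 := h2 n; have a3 := h1 (n + 1); have a4 := h2 (n + 1)
        rw [Finset.sum_range_succ, Finset.sum_range_succ _ (n + 1 + 1),
          Finset.sum_range_succ μ.rowLen]
        simp only [tog] at ih ⊢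
        omega
    have := e3 ξ.card
    rw [← e1, ← e2, hξz _ (by omega), Nat.zero_min, add_zero, Finset.sum_add_distrib,
      ← card_eq_sum_rowLen (μ := ν) (rowLen_eq_zero (by omega))] at this
    rw [card_eq_sum_rowLen z, Finset.sum_congr rfl fun i _ => row_tog ν h1 h2 i]
    exact this
  refine Finset.card_le_card_of_injOn (fun ν => ofRows N (tog ν)) ?_ ?_
  · intro ν hν
    simp only [Finset.coe_filter, Set.mem_ofPred_eq, mem_cardLE] at hν ⊢
    obtain ⟨_, h1, h2, h3, h4⟩ := hν
    have hs := sum_tog ν h1 h2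
    refine ⟨by omega, ?_, ?_, by omega, by omega⟩ <;>
    · intro i
      rw [row_tog ν h1 h2]
      try rw [row_tog ν h1 h2]
      have := bds ν h1 h2 i
      omega
  · intro ν hν ν' hν' he
    simp only [Finset.coe_filter, Set.mem_ofPred_eq, mem_cardLE] at hν hν' he
    obtain ⟨_, h1, h2, h3, h4⟩ := hν
    obtain ⟨_, h1', h2', h3', h4'⟩ := hν'
    refine ext_rowLen fun i => ?_
    have e : tog ν i = tog ν' i := by rw [← row_tog ν h1 h2, he, row_tog ν' h1' h2']
    cases i with
    | zero =>
      have a1 := h1 0; have a2 := h2 0; have a3 := h1' 0; have a4 := h2' 0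
      simp only [tog] at e
      omega
    | succ i =>
      have a1 := h1 i; have a2 := h2 i; have a3 := h1' i; have a4 := h2' i
      have b1 := h1 (i + 1); have b2 := h2 (i + 1); have b3 := h1' (i + 1); have b4 := h2' (i + 1)
      simp only [tog] at *
      omega

open Classical in
theorem card_chains_comm {μ ξ : YoungDiagram} {a b M : ℕ} (hM : ξ.card ≤ M) :
    ((cardLE M).filter fun ν => IsHStrip μ ν ∧ IsHStrip ν ξ ∧
        ξ.card = ν.card + a ∧ ν.card = μ.card + b).card =
      ((cardLE M).filter fun ν => IsHStrip μ ν ∧ IsHStrip ν ξ ∧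
        ξ.card = ν.card + b ∧ ν.card = μ.card + a).card :=
  le_antisymm (card_chains_le hM) (card_chains_le hM)

end YoungDiagram

/-! ### Kostka numbers and the branching rule -/

namespace SemistandardYoungTableau

open YoungDiagram

variable {μ : YoungDiagram}

/-- The weight of a semistandard tableau: the multiplicities of its entries. -/
noncomputable def weight (T : SemistandardYoungTableau μ) : ℕ →₀ ℕ :=
  ∑ c ∈ μ.cells, Finsupp.single (T c.1 c.2) 1

theorem weight_apply (T : SemistandardYoungTableau μ) (v : ℕ) :
    T.weight v = (μ.cells.filter fun c => T c.1 c.2 = v).card := by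
  classical
  rw [weight, Finsupp.finsetSum_apply, Finset.card_filter]
  exact Finset.sum_congr rfl fun c _ => Finsupp.single_apply

theorem degree_weight (T : SemistandardYoungTableau μ) : T.weight.degree = μ.card := by
  simp [weight, map_sum, Finsupp.degree_single]

theorem weight_ne_zero (T : SemistandardYoungTableau μ) {i j : ℕ} (h : (i, j) ∈ μ) :
    T.weight (T i j) ≠ 0 := by
  rw [weight_apply, Finset.card_ne_zero]
  exact ⟨(i, j), Finset.mem_filter.2 ⟨h, rfl⟩⟩

instance finite_weight (μ : YoungDiagram) (f : ℕ →₀ ℕ) :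
    Finite {T : SemistandardYoungTableau μ // T.weight = f} := by
  let Φ : {T : SemistandardYoungTableau μ // T.weight = f} → (μ.cells → f.support) := fun T c =>
    ⟨T.1 c.1.1 c.1.2, by
      have := T.1.weight_ne_zero c.2
      rwa [T.2, ← Finsupp.mem_support_iff] at this⟩
  refine Finite.of_injective Φ fun T T' h => Subtype.ext (SemistandardYoungTableau.ext fun i j => ?_)
  by_cases hc : (i, j) ∈ μ
  · have := congrFun h ⟨(i, j), hc⟩
    exact congrArg Subtype.val this
  · rw [T.1.zeros hc, T'.1.zeros hc]

/-- The number of semistandard tableaux of shape `μ` and weight `f`. -/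
noncomputable def kostka (μ : YoungDiagram) (f : ℕ →₀ ℕ) : ℕ :=
  Nat.card {T : SemistandardYoungTableau μ // T.weight = f}

theorem card_eq_of_kostka_ne_zero {f : ℕ →₀ ℕ} (h : kostka μ f ≠ 0) : μ.card = f.degree := by
  obtain ⟨T, rfl⟩ := (Nat.card_ne_zero.1 h).1
  exact T.degree_weight.symm

theorem kostka_zero [DecidableEq YoungDiagram] : kostka μ 0 = if μ = ⊥ then 1 else 0 := by
  split_ifs with h
  · subst h
    have : Unique {T : SemistandardYoungTableau ⊥ // T.weight = 0} :=
      { default := ⟨highestWeight ⊥, by simp [weight]⟩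
        uniq := fun T => Subtype.ext (SemistandardYoungTableau.ext fun i j => by
          rw [T.1.zeros (YoungDiagram.notMem_bot _), zeros _ (YoungDiagram.notMem_bot _)]) }
    exact Nat.card_unique
  · by_contra hc
    have := card_eq_of_kostka_ne_zero hc
    rw [map_zero, Finset.card_eq_zero] at this
    exact h (YoungDiagram.ext this)

/-- The shape formed by the entries smaller than `N`. -/
noncomputable def below (T : SemistandardYoungTableau μ) (N : ℕ) : YoungDiagram where
  cells := μ.cells.filter fun c => T c.1 c.2 < N
  isLowerSet := by
    rintro ⟨a, b⟩ ⟨a', b'⟩ ⟨h1, h2⟩ h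
    simp only [Finset.coe_filter, Set.mem_ofPred_eq, mem_cells] at h h1 h2 ⊢
    have h3 : (a', b) ∈ μ := μ.up_left_mem h1 le_rfl h.1
    exact ⟨μ.up_left_mem h1 h2 h.1,
      ((T.row_weak_of_le h2 h3).trans (T.col_weak h1 h.1)).trans_lt h.2⟩

theorem mem_below {T : SemistandardYoungTableau μ} {N i j : ℕ} :
    (i, j) ∈ T.below N ↔ (i, j) ∈ μ ∧ T i j < N := by
  change (i, j) ∈ Finset.filter _ _ ↔ _
  rw [Finset.mem_filter, mem_cells]

theorem entry_le {T : SemistandardYoungTableau μ} {N : ℕ} (hf : ∀ v, T.weight v ≠ 0 → v ≤ N)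
    {i j : ℕ} (h : (i, j) ∈ μ) : T i j ≤ N :=
  hf _ (T.weight_ne_zero h)

/-- Columns increase strictly, so the largest value `N` occurs at most once in each column, at its
bottom. -/
theorem isHStrip_below {T : SemistandardYoungTableau μ} {N : ℕ}
    (hf : ∀ v, T.weight v ≠ 0 → v ≤ N) :
    IsHStrip (T.below N) μ ∧ μ.card = (T.below N).card + T.weight N := by
  refine ⟨fun i => ⟨?_, ?_⟩, ?_⟩
  · refine le_of_forall_lt fun j hj => ?_
    rw [← mem_iff_lt_rowLen] at hj ⊢
    exact mem_below.2 ⟨μ.up_left_mem (Nat.le_succ i) le_rfl hj,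
      (T.col_strict (Nat.lt_succ_self i) hj).trans_le (entry_le hf hj)⟩
  · refine le_of_forall_lt fun j hj => ?_
    rw [← mem_iff_lt_rowLen] at hj ⊢
    exact (mem_below.1 hj).1
  · rw [weight_apply]
    change _ = (μ.cells.filter fun c => T c.1 c.2 < N).card + _
    rw [YoungDiagram.card,
      ← Finset.card_filter_add_card_filter_not (s := μ.cells) (fun c => T c.1 c.2 < N)]
    congr 2
    refine Finset.filter_congr ?_
    rintro ⟨i, j⟩ hc
    have := entry_le hf (show (i, j) ∈ μ from hc)
    simp only
    omega

/-- Forget the cells outside `ν`. -/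
def restrict (T : SemistandardYoungTableau μ) (ν : YoungDiagram) (hν : ν ≤ μ)
    [DecidablePred (· ∈ ν)] : SemistandardYoungTableau ν where
  entry i j := if (i, j) ∈ ν then T i j else 0
  row_weak' := by
    intro i j1 j2 hj hc
    rw [if_pos hc, if_pos (ν.up_left_mem le_rfl hj.le hc)]
    exact T.row_weak hj (hν hc)
  col_strict' := by
    intro i1 i2 j hi hc
    rw [if_pos hc, if_pos (ν.up_left_mem hi.le le_rfl hc)]
    exact T.col_strict hi (hν hc)
  zeros' := fun h => if_neg h

/-- Put the entry `N` into all cells outside `ν`. -/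
def extendBy {ν : YoungDiagram} (T : SemistandardYoungTableau ν) (μ : YoungDiagram)
    (h : IsHStrip ν μ) (N : ℕ) (hN : ∀ i j, (i, j) ∈ ν → T i j < N)
    [DecidablePred (· ∈ ν)] [DecidablePred (· ∈ μ)] : SemistandardYoungTableau μ where
  entry i j := if (i, j) ∈ ν then T i j else if (i, j) ∈ μ then N else 0
  row_weak' := by
    intro i j1 j2 hj hc
    by_cases h2 : (i, j2) ∈ ν
    · rw [if_pos h2, if_pos (ν.up_left_mem le_rfl hj.le h2)]
      exact T.row_weak hj h2
    · rw [if_neg h2, if_pos hc, if_pos (μ.up_left_mem le_rfl hj.le hc)]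
      split_ifs with h1
      · exact (hN _ _ h1).le
      · exact le_rfl
  col_strict' := by
    intro i1 i2 j hi hc
    have h1 := h.mem_of_lt hi hc
    rw [if_pos h1]
    by_cases h2 : (i2, j) ∈ ν
    · rw [if_pos h2]
      exact T.col_strict hi h2
    · rw [if_neg h2, if_pos hc]
      exact hN _ _ h1
  zeros' := by
    intro i j hc
    rw [if_neg fun h' => hc (h.le h'), if_neg hc]

theorem restrict_apply (T : SemistandardYoungTableau μ) (ν : YoungDiagram) (hν : ν ≤ μ)
    [DecidablePred (· ∈ ν)] (i j : ℕ) :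
    T.restrict ν hν i j = if (i, j) ∈ ν then T i j else 0 := rfl

theorem extendBy_apply {ν : YoungDiagram} (T : SemistandardYoungTableau ν) (μ : YoungDiagram)
    (h : IsHStrip ν μ) (N : ℕ) (hN : ∀ i j, (i, j) ∈ ν → T i j < N)
    [DecidablePred (· ∈ ν)] [DecidablePred (· ∈ μ)] (i j : ℕ) :
    T.extendBy μ h N hN i j = if (i, j) ∈ ν then T i j else if (i, j) ∈ μ then N else 0 := rfl

-- Deleting the cells with entry `N` and filling the cells of μ / ν with `N` are inverse to each
-- other.
open Classical in
theorem card_below_eq_kostka {ν : YoungDiagram} {f : ℕ →₀ ℕ} {N : ℕ} (hf : ∀ v, f v ≠ 0 → v ≤ N)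
    (h : IsHStrip ν μ) (hcard : μ.card = ν.card + f N) :
    Nat.card {T : SemistandardYoungTableau μ // T.weight = f ∧ T.below N = ν} =
      kostka ν (f.erase N) := by
  have hlt : ∀ T : {T : SemistandardYoungTableau ν // T.weight = f.erase N}, ∀ i j,
      (i, j) ∈ ν → T.1 i j < N := by
    rintro ⟨T, hT⟩ i j hc
    have := T.weight_ne_zero hc
    rw [hT] at this
    have h1 : T i j ≠ N := fun he => this (by rw [he, Finsupp.erase_same])
    rw [Finsupp.erase_ne h1] at this
    exact lt_of_le_of_ne (hf _ this) h1
  refine Nat.card_congr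
    { toFun := fun T => ⟨T.1.restrict ν h.le, ?_⟩
      invFun := fun T => ⟨T.1.extendBy μ h N (hlt T), ?_, ?_⟩
      left_inv := ?_
      right_inv := ?_ }
  · obtain ⟨T, rfl, rfl⟩ := T
    ext v
    rw [weight_apply]
    by_cases hv : v = N
    · subst hv
      rw [Finsupp.erase_same, Finset.card_eq_zero, Finset.filter_eq_empty_iff]
      rintro ⟨i, j⟩ hc
      rw [mem_cells] at hc
      rw [restrict_apply, if_pos hc]
      exact (mem_below.1 hc).2.ne
    · rw [Finsupp.erase_ne hv, weight_apply]
      congr 1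
      ext ⟨i, j⟩
      rw [Finset.mem_filter, Finset.mem_filter, mem_cells, mem_cells, restrict_apply]
      dsimp only
      constructor
      · rintro ⟨h1, h2⟩
        rw [if_pos h1] at h2
        exact ⟨(mem_below.1 h1).1, h2⟩
      · rintro ⟨h1, h2⟩
        have h3 : (i, j) ∈ T.below N := mem_below.2 ⟨h1, lt_of_le_of_ne (entry_le hf h1) (h2 ▸ hv)⟩
        rw [if_pos h3]
        exact ⟨h3, h2⟩
  · have hsub : ν.cells ⊆ μ.cells := cells_subset_iff.2 h.le
    rw [weight, ← Finset.sum_sdiff hsub]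
    have e1 : ∀ c ∈ μ.cells \ ν.cells,
        Finsupp.single ((T.1.extendBy μ h N (hlt T)) c.1 c.2) 1 = Finsupp.single N 1 := by
      rintro ⟨i, j⟩ hc
      rw [Finset.mem_sdiff, mem_cells, mem_cells] at hc
      simp only [extendBy_apply]
      rw [if_neg hc.2, if_pos hc.1]
    have e2 : ∀ c ∈ ν.cells,
        Finsupp.single ((T.1.extendBy μ h N (hlt T)) c.1 c.2) 1 = Finsupp.single (T.1 c.1 c.2) 1 := by
      rintro ⟨i, j⟩ hc
      rw [mem_cells] at hc
      simp only [extendBy_apply]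
      rw [if_pos hc]
    rw [Finset.sum_congr rfl e1, Finset.sum_congr rfl e2]
    change _ + T.1.weight = f
    rw [T.2, Finset.sum_const, Finset.card_sdiff_of_subset hsub, Finsupp.smul_single, smul_eq_mul,
      mul_one, show μ.cells.card - ν.cells.card = f N by
        change μ.card = ν.cells.card + f N at hcard
        change μ.card - _ = _
        omega, Finsupp.single_add_erase]
  · ext ⟨i, j⟩
    rw [mem_cells, mem_cells, mem_below]
    rw [extendBy_apply]
    constructor
    · rintro ⟨h1, h2⟩
      by_contra h3
      rw [if_neg h3, if_pos h1] at h2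
      exact lt_irrefl _ h2
    · intro h1
      rw [if_pos h1]
      exact ⟨h.le h1, hlt T i j h1⟩
  · rintro ⟨T, hT, rfl⟩
    refine Subtype.ext (SemistandardYoungTableau.ext fun i j => ?_)
    simp only [extendBy_apply, restrict_apply]
    by_cases h1 : (i, j) ∈ T.below N
    · rw [if_pos h1, if_pos h1]
    · rw [if_neg h1]
      split_ifs with h2
      · subst hT
        have := entry_le hf h2
        by_contra h3
        exact h1 (mem_below.2 ⟨h2, lt_of_le_of_ne this (Ne.symm h3)⟩)
      · rw [T.zeros h2]
  · rintro ⟨T, hT⟩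
    refine Subtype.ext (SemistandardYoungTableau.ext fun i j => ?_)
    simp only [extendBy_apply, restrict_apply]
    by_cases h1 : (i, j) ∈ ν
    · rw [if_pos h1, if_pos h1]
    · rw [if_neg h1, T.zeros h1]

-- The branching rule: tableaux are sorted by the shape that remains after the largest value is
-- removed.
open Classical in
theorem kostka_eq_sum {f : ℕ →₀ ℕ} {N M : ℕ} (hf : ∀ v, f v ≠ 0 → v ≤ N) (hM : μ.card ≤ M) :
    kostka μ f = ∑ ν ∈ cardLE M,
      if IsHStrip ν μ ∧ μ.card = ν.card + f N then kostka ν (f.erase N) else 0 := by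
  rw [← Finset.sum_filter]
  let _ := Fintype.ofFinite {T : SemistandardYoungTableau μ // T.weight = f}
  rw [kostka, Nat.card_eq_fintype_card, ← Finset.card_univ]
  rw [Finset.card_eq_sum_card_fiberwise (f := fun T => T.1.below N)
    (t := (cardLE M).filter fun ν => IsHStrip ν μ ∧ μ.card = ν.card + f N)]
  · refine Finset.sum_congr rfl fun ν hν => ?_
    rw [Finset.mem_filter] at hν
    rw [← card_below_eq_kostka hf hν.2.1 hν.2.2, ← Fintype.card_subtype, ← Nat.card_eq_fintype_card]
    exact Nat.card_congr (Equiv.subtypeSubtypeEquivSubtypeInter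
      (fun T : SemistandardYoungTableau μ => T.weight = f) (fun T => T.below N = ν))
  · rintro ⟨T, rfl⟩ -
    have := isHStrip_below hf
    simp only [Finset.coe_filter, Set.mem_ofPred_eq, mem_cardLE]
    exact ⟨this.1.card_le.trans hM, this⟩

end SemistandardYoungTableau

/-! ### Pieri's rule and symmetry of Kostka numbers -/

namespace Finsupp

/-- An exponent vector below `f` is a value at `a` together with an exponent vector below `f.erase
a`; this isolates the largest variable in the induction for Pieri's rule. -/
theorem sum_Iic_eq {ι M : Type*} [DecidableEq ι] [AddCommMonoid M] (f : ι →₀ ℕ) (a : ι)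
    (F : (ι →₀ ℕ) → M) :
    ∑ h ∈ Finset.Iic f, F h =
      ∑ j ∈ Finset.range (f a + 1), ∑ h ∈ Finset.Iic (f.erase a), F (h.update a j) := by
  rw [← Finset.sum_product']
  refine Finset.sum_nbij' (fun h => (h a, h.erase a)) (fun p => p.2.update a p.1) ?_ ?_ ?_ ?_ ?_
  · intro h hh
    rw [Finset.mem_Iic] at hh
    rw [Finset.mem_product, Finset.mem_range, Finset.mem_Iic]
    refine ⟨Nat.lt_succ_of_le (hh a), fun i => ?_⟩
    by_cases hi : i = a
    · simp [hi]
    · simpa [Finsupp.erase_ne hi] using hh i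
  · rintro ⟨j, h⟩ hh
    rw [Finset.mem_product, Finset.mem_range, Finset.mem_Iic] at hh
    rw [Finset.mem_Iic]
    intro i
    by_cases hi : i = a
    · subst hi
      simpa using Nat.le_of_lt_succ hh.1
    · have := hh.2 i
      rw [Finsupp.erase_ne hi] at this
      simpa [Function.update_of_ne hi] using this
  · intro h _
    ext i
    by_cases hi : i = a
    · subst hi; simp
    · simp [hi]
  · rintro ⟨j, h⟩ hh
    rw [Finset.mem_product, Finset.mem_range, Finset.mem_Iic] at hh
    refine Prod.ext (by simp) ?_
    ext i
    by_cases hi : i = a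
    · subst hi
      have := hh.2 i
      simp at this
      simp [this]
    · simp [hi]
  · intro h _
    congr 1
    ext i
    by_cases hi : i = a
    · subst hi; simp
    · simp [hi]

end Finsupp

namespace SemistandardYoungTableau

open YoungDiagram

open Classical in
/-- Pieri's rule for the numbers of semistandard tableaux. -/
theorem sum_kostka_of_isHStrip (ν : YoungDiagram) {f : ℕ →₀ ℕ} {M : ℕ} (hM : f.degree ≤ M) :
    ∑ μ ∈ cardLE M, (if IsHStrip ν μ then kostka μ f else 0) =
      ∑ h ∈ Finset.Iic f, kostka ν h := by
  obtain ⟨N, hN⟩ : ∃ N, ∀ v, f v ≠ 0 → v < N := by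
    obtain ⟨N, hN⟩ := f.support.exists_nat_subset_range
    exact ⟨N, fun v hv => Finset.mem_range.1 (hN (Finsupp.mem_support_iff.2 hv))⟩
  induction N generalizing f M ν with
  | zero =>
    obtain rfl : f = 0 := by
      ext v
      by_contra hv
      exact absurd (hN v hv) (by omega)
    have e : Finset.Iic (0 : ℕ →₀ ℕ) = {0} := by
      ext h
      simp
    rw [e, Finset.sum_singleton, Finset.sum_eq_single (⊥ : YoungDiagram)]
    · rw [kostka_zero, kostka_zero, if_pos rfl]
      by_cases hν : ν = ⊥
      · subst hν
        rw [if_pos rfl, if_pos]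
        intro i
        simp [rowLen_eq_zero (μ := ⊥) (N := i + 1) (by simp [YoungDiagram.card])]
      · rw [if_neg hν, if_neg]
        exact fun h => hν (le_bot_iff.1 h.le)
    · intro μ _ hμ
      rw [kostka_zero, if_neg hμ, ite_self]
    · intro h
      exact absurd (mem_cardLE.2 (by simp [YoungDiagram.card])) h
  | succ N ih =>
    have hf : ∀ v, f v ≠ 0 → v ≤ N := fun v hv => Nat.lt_succ_iff.1 (hN v hv)
    set f' := f.erase N with hf'
    set b := f N with hb
    have hf'N : ∀ v, f' v ≠ 0 → v < N := by
      intro v hv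
      have h1 : v ≠ N := by
        rintro rfl
        exact hv (by simp [hf'])
      rw [hf', Finsupp.erase_ne h1] at hv
      exact lt_of_le_of_ne (hf v hv) h1
    have hdeg : f.degree = f'.degree + b := by
      conv_lhs => rw [← Finsupp.erase_add_single N f]
      rw [map_add, Finsupp.degree_single]
    -- Removing the value `N` from the tableau of shape μ leaves a shape κ; what remains is to count
    -- the common upper strips μ of ν and κ.
    have lhs : ∑ μ ∈ cardLE M, (if IsHStrip ν μ then kostka μ f else 0) =
        ∑ κ ∈ cardLE M, kostka κ f' * ((cardLE M).filter fun μ =>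
          IsHStrip ν μ ∧ IsHStrip κ μ ∧ μ.card = κ.card + b).card := by
      simp only [Finset.card_filter, Finset.mul_sum]
      rw [Finset.sum_comm]
      refine Finset.sum_congr rfl fun μ hμ => ?_
      split_ifs with h1
      · rw [kostka_eq_sum hf (mem_cardLE.1 hμ)]
        refine Finset.sum_congr rfl fun κ _ => ?_
        simp only [h1, true_and, mul_ite, mul_one, mul_zero]
        rfl
      · refine (Finset.sum_eq_zero fun κ _ => ?_).symm
        rw [if_neg fun h => h1 h.1, mul_zero]
    -- Removing `N` from the tableau of shape ν leaves τ, and the induction hypothesis for τ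
    -- introduces κ. Summing over the multiplicity j ≤ b of `N` leaves the condition |ν| ≤ |τ| + b
    -- on the common lower strips.
    have rhs : ∑ h ∈ Finset.Iic f, kostka ν h =
        ∑ κ ∈ cardLE M, kostka κ f' * ((cardLE ν.card).filter fun τ =>
          IsHStrip τ ν ∧ IsHStrip τ κ ∧ ν.card ≤ τ.card + b).card := by
      rw [Finsupp.sum_Iic_eq f N]
      have e1 : ∀ j, ∀ h ∈ Finset.Iic f', kostka ν (h.update N j) = ∑ τ ∈ cardLE ν.card,
          if IsHStrip τ ν ∧ ν.card = τ.card + j then kostka τ h else 0 := by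
        intro j h hh
        rw [Finset.mem_Iic] at hh
        have h0 : h N = 0 := by
          have := hh N
          simpa [hf'] using this
        rw [kostka_eq_sum (N := N) (M := ν.card) _ le_rfl]
        · refine Finset.sum_congr rfl fun τ _ => ?_
          have e2 : (h.update N j).erase N = h := by
            ext i
            by_cases hi : i = N
            · subst hi; simp [h0]
            · simp [Finsupp.erase_ne hi]
          rw [e2]
          simp
        · intro v hv
          by_contra hc
          have h1 : v ≠ N := by omega
          simp only [Finsupp.coe_update, Function.update_of_ne h1] at hv
          have := hh v
          have := hf'N v (by omega)
          omega
      rw [Finset.sum_congr rfl fun j _ => Finset.sum_congr rfl (e1 j)]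
      have e3 : ∀ j, ∑ h ∈ Finset.Iic f', (∑ τ ∈ cardLE ν.card,
          if IsHStrip τ ν ∧ ν.card = τ.card + j then kostka τ h else 0) =
          ∑ κ ∈ cardLE M, ∑ τ ∈ cardLE ν.card,
            if IsHStrip τ ν ∧ IsHStrip τ κ ∧ ν.card = τ.card + j then kostka κ f' else 0 := by
        intro j
        rw [Finset.sum_comm, Finset.sum_comm (s := cardLE M)]
        refine Finset.sum_congr rfl fun τ _ => ?_
        by_cases h1 : IsHStrip τ ν ∧ ν.card = τ.card + j
        · simp only [if_pos h1]
          rw [← ih τ (M := M) (by omega) hf'N]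
          refine Finset.sum_congr rfl fun κ _ => ?_
          simp only [h1.1, ← h1.2, true_and, and_true]
        · simp only [if_neg h1, Finset.sum_const_zero]
          refine (Finset.sum_eq_zero fun κ _ => if_neg fun h => h1 ⟨h.1, h.2.2⟩).symm
      rw [Finset.sum_congr rfl fun j _ => e3 j, Finset.sum_comm]
      refine Finset.sum_congr rfl fun κ _ => ?_
      rw [Finset.sum_comm, Finset.card_filter, Finset.mul_sum]
      refine Finset.sum_congr rfl fun τ _ => ?_
      by_cases h1 : IsHStrip τ ν ∧ IsHStrip τ κ
      · simp only [h1.1, h1.2, true_and]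
        have h2 := h1.1.card_le
        by_cases h3 : ν.card ≤ τ.card + b
        · rw [if_pos h3, mul_one, Finset.sum_eq_single (ν.card - τ.card)]
          · rw [if_pos (by omega)]
          · intro j _ hj
            rw [if_neg (by omega)]
          · intro h
            rw [Finset.mem_range] at h
            omega
        · rw [if_neg h3, mul_zero]
          refine Finset.sum_eq_zero fun j hj => ?_
          rw [Finset.mem_range] at hj
          rw [if_neg (by omega)]
      · rw [if_neg fun h => h1 ⟨h.1, h.2.1⟩, mul_zero]
        exact Finset.sum_eq_zero fun j _ => if_neg fun h => h1 ⟨h.1, h.2.1⟩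
    rw [lhs, rhs]
    refine Finset.sum_congr rfl fun κ _ => ?_
    -- A nonzero Kostka number fixes |κ| as the degree of `f'`, which puts all the common upper
    -- strips of size |κ| + b into `cardLE M`.
    by_cases h0 : kostka κ f' = 0
    · rw [h0, zero_mul, zero_mul]
    · rw [card_commonStrips (M' := ν.card) _ le_rfl]
      rw [card_eq_of_kostka_ne_zero h0]
      omega

open Classical in
/-- The number of chains of horizontal strips of prescribed sizes ending in `μ`. -/
noncomputable def chainCount : List ℕ → YoungDiagram → ℕ
  | [], μ => if μ = ⊥ then 1 else 0
  | b :: l, μ => ∑ ν ∈ cardLE μ.card,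
      if IsHStrip ν μ ∧ μ.card = ν.card + b then chainCount l ν else 0

/-- Iterated branching. The list is reversed because its head is the size of the outermost strip,
which holds the largest entries. -/
theorem kostka_eq_chainCount {f : ℕ →₀ ℕ} {N : ℕ} (hf : ∀ v, f v ≠ 0 → v < N)
    (μ : YoungDiagram) : kostka μ f = chainCount ((List.range N).reverse.map f) μ := by
  classical
  induction N generalizing f μ with
  | zero =>
    obtain rfl : f = 0 := by
      ext v
      by_contra hv
      exact absurd (hf v hv) (by omega)
    simp [chainCount, kostka_zero]
  | succ N ih =>
    rw [kostka_eq_sum (N := N) (fun v hv => Nat.lt_succ_iff.1 (hf v hv)) le_rfl, List.range_succ,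
      List.reverse_append]
    simp only [List.reverse_cons, List.reverse_nil, List.nil_append, List.cons_append,
      List.map_cons, chainCount]
    refine Finset.sum_congr rfl fun ν _ => ?_
    congr 1
    rw [ih]
    · congr 1
      refine List.map_congr_left fun v hv => ?_
      rw [List.mem_reverse, List.mem_range] at hv
      rw [Finsupp.erase_ne (by omega)]
    · intro v hv
      have h1 : v ≠ N := by
        rintro rfl
        exact hv (by simp)
      rw [Finsupp.erase_ne h1] at hv
      have := hf v hv
      omega

open Classical in
theorem chainCount_cons (b : ℕ) (l : List ℕ) {μ : YoungDiagram} {M : ℕ} (hM : μ.card ≤ M) :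
    chainCount (b :: l) μ = ∑ ν ∈ cardLE M,
      if IsHStrip ν μ ∧ μ.card = ν.card + b then chainCount l ν else 0 := by
  rw [chainCount]
  refine Finset.sum_subset ?_ ?_
  · intro ν hν
    rw [mem_cardLE] at hν ⊢
    exact hν.trans hM
  · intro ν _ hν
    rw [mem_cardLE] at hν
    exact if_neg fun h => hν h.1.card_le

/-- Adjacent transpositions generate all permutations, and one of them is an exchange of two
consecutive strip sizes, handled by `card_chains_comm`. -/
theorem chainCount_perm {l l' : List ℕ} (h : l.Perm l') (μ : YoungDiagram) :
    chainCount l μ = chainCount l' μ := by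
  classical
  induction h generalizing μ with
  | nil => rfl
  | cons b _ ih =>
    rw [chainCount, chainCount]
    exact Finset.sum_congr rfl fun ν _ => by rw [ih]
  | trans _ _ ih1 ih2 => rw [ih1, ih2]
  | swap a b l =>
    have key : ∀ a b : ℕ, chainCount (a :: b :: l) μ = ∑ ξ ∈ cardLE μ.card, chainCount l ξ *
        ((cardLE μ.card).filter fun ν => IsHStrip ξ ν ∧ IsHStrip ν μ ∧
          μ.card = ν.card + a ∧ ν.card = ξ.card + b).card := by
      intro a b
      rw [chainCount_cons a _ le_rfl]
      simp only [Finset.card_filter, Finset.mul_sum]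
      rw [Finset.sum_comm]
      refine Finset.sum_congr rfl fun ν hν => ?_
      split_ifs with h1
      · rw [chainCount_cons b _ (mem_cardLE.1 hν)]
        refine Finset.sum_congr rfl fun ξ _ => ?_
        simp only [h1.1, ← h1.2, true_and, mul_ite, mul_one, mul_zero]
      · refine (Finset.sum_eq_zero fun ξ _ => ?_).symm
        rw [if_neg fun h => h1 ⟨h.2.1, h.2.2.1⟩, mul_zero]
    rw [key, key]
    exact Finset.sum_congr rfl fun ξ _ => by rw [card_chains_comm le_rfl]

theorem chainCount_zero_cons (l : List ℕ) (μ : YoungDiagram) :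
    chainCount (0 :: l) μ = chainCount l μ := by
  classical
  rw [chainCount, Finset.sum_eq_single μ]
  · rw [if_pos]
    exact ⟨fun i => ⟨μ.rowLen_anti _ _ (Nat.le_succ i), le_rfl⟩, rfl⟩
  · intro ν _ hν
    refine if_neg fun h => hν (YoungDiagram.ext ?_)
    exact Finset.eq_of_subset_of_card_le (cells_subset_iff.2 h.1.le) h.2.le
  · intro h
    exact absurd (mem_cardLE.2 le_rfl) h

theorem chainCount_filter (l : List ℕ) (μ : YoungDiagram) :
    chainCount (l.filter (· ≠ 0)) μ = chainCount l μ := by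
  classical
  induction l generalizing μ with
  | nil => rfl
  | cons b l ih =>
    by_cases hb : b = 0
    · subst hb
      rw [chainCount_zero_cons, ← ih, List.filter_cons_of_neg (by simp)]
    · rw [List.filter_cons_of_pos (by simpa using hb), chainCount, chainCount]
      exact Finset.sum_congr rfl fun ν _ => by rw [ih]

/-- Empty strips may be dropped and the others reordered, so a Kostka number depends only on the
multiset of nonzero multiplicities; renaming the variables preserves this multiset. -/
theorem kostka_mapDomain (μ : YoungDiagram) (f : ℕ →₀ ℕ) (g : Equiv.Perm ℕ) :
    kostka μ (f.mapDomain g) = kostka μ f := by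
  classical
  have hb : ∀ f : ℕ →₀ ℕ, ∃ N, ∀ v, f v ≠ 0 → v < N := by
    intro f
    obtain ⟨N, hN⟩ := f.support.exists_nat_subset_range
    exact ⟨N, fun v hv => Finset.mem_range.1 (hN (Finsupp.mem_support_iff.2 hv))⟩
  have key : ∀ (f : ℕ →₀ ℕ) (N : ℕ), (∀ v, f v ≠ 0 → v < N) →
      ((((List.range N).reverse.map f).filter (· ≠ 0) : List ℕ) : Multiset ℕ) =
        f.support.val.map f := by
    intro f N hN
    rw [← Multiset.filter_coe, ← Multiset.map_coe, Multiset.filter_map, Multiset.coe_reverse,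
      Multiset.coe_range]
    congr 1
    have : f.support = (Finset.range N).filter fun v => f v ≠ 0 := by
      ext v
      simp only [Finsupp.mem_support_iff, Finset.mem_filter, Finset.mem_range]
      exact ⟨fun h => ⟨hN v h, h⟩, fun h => h.2⟩
    rw [this]
    rfl
  obtain ⟨N, hN⟩ := hb f
  obtain ⟨N', hN'⟩ := hb (f.mapDomain g)
  rw [kostka_eq_chainCount hN, kostka_eq_chainCount hN', ← chainCount_filter,
    ← chainCount_filter ((List.range N).reverse.map f)]
  refine chainCount_perm (Multiset.coe_eq_coe.1 ?_) μ
  rw [key _ _ hN, key _ _ hN', ← Finsupp.equivMapDomain_eq_mapDomain]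
  change ((f.support.map g.toEmbedding).val).map _ = _
  rw [Finset.map_val, Multiset.map_map]
  refine Multiset.map_congr rfl fun v _ => ?_
  simp

end SemistandardYoungTableau

open SemistandardYoungTableau YoungDiagram

/-! ### Schur functions of r-partitions: symmetry, independence, the map ω -/

section Multi

variable {r : ℕ}

/-- The exponents of the variables `x^{(i+1)}` in an exponent vector. -/
noncomputable def component (m : VarIndex r →₀ ℕ) (i : Fin r) : ℕ →₀ ℕ :=
  m.comapDomain (Prod.mk i) (Prod.mk_right_injective i).injOn

theorem component_apply (m : VarIndex r →₀ ℕ) (i : Fin r) (v : ℕ) : component m i v = m (i, v) :=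
  rfl

theorem component_injective {m m' : VarIndex r →₀ ℕ} (h : ∀ i, component m i = component m' i) :
    m = m' := by
  ext ⟨i, v⟩
  exact DFunLike.congr_fun (h i) v

theorem component_tableauWeight {lam : Fin r → YoungDiagram}
    (T : ∀ i, SemistandardYoungTableau (lam i)) (i : Fin r) :
    component (tableauWeight T) i = (T i).weight := by
  ext v
  rw [component_apply, tableauWeight, Finsupp.finsetSum_apply, Finset.sum_eq_single i,
    Finsupp.finsetSum_apply, weight, Finsupp.finsetSum_apply]
  · refine Finset.sum_congr rfl fun c _ => ?_
    classical
    rw [Finsupp.single_apply, Finsupp.single_apply]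
    simp
  · intro j _ hj
    rw [Finsupp.finsetSum_apply]
    refine Finset.sum_eq_zero fun c _ => ?_
    rw [Finsupp.single_eq_of_ne]
    intro h
    exact hj (congrArg Prod.fst h).symm
  · intro h
    exact absurd (Finset.mem_univ i) h

theorem tableauWeight_eq_iff {lam : Fin r → YoungDiagram}
    {T : ∀ i, SemistandardYoungTableau (lam i)} {m : VarIndex r →₀ ℕ} :
    tableauWeight T = m ↔ ∀ i, (T i).weight = component m i := by
  constructor
  · rintro rfl i
    rw [component_tableauWeight]
  · intro h
    refine component_injective fun i => ?_
    rw [component_tableauWeight, h]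

/-- The coefficient of `x^m` in the Schur function of the `r`-partition `lam`. -/
noncomputable def schurCount (lam : Fin r → YoungDiagram) (m : VarIndex r →₀ ℕ) : ℕ :=
  ∏ i, kostka (lam i) (component m i)

theorem coeff_schur (lam : Fin r → YoungDiagram) (m : VarIndex r →₀ ℕ) :
    MvPowerSeries.coeff m (schur lam) = schurCount lam m := by
  change ((Nat.card _ : ℕ) : ℚ) = _
  congr 1
  rw [schurCount]
  simp only [kostka]
  rw [← Nat.card_pi]
  refine Nat.card_congr ((Equiv.subtypeEquivRight fun T => tableauWeight_eq_iff).trans ?_)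
  exact Equiv.subtypePiEquivPi (p := fun i (T : SemistandardYoungTableau (lam i)) =>
    T.weight = component m i)

theorem degree_eq_sum_component (m : VarIndex r →₀ ℕ) :
    m.degree = ∑ i, (component m i).degree := by
  classical
  induction m using Finsupp.induction_linear with
  | zero => simp [component]
  | add f g hf hg =>
    rw [map_add, hf, hg, ← Finset.sum_add_distrib]
    refine Finset.sum_congr rfl fun i _ => ?_
    rw [← map_add]
    congr 1
    ext v
    rfl
  | single p k =>
    obtain ⟨i, v⟩ := p
    rw [Finsupp.degree_single, Finset.sum_eq_single i]
    · have : component (Finsupp.single (i, v) k) i = Finsupp.single v k := by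
        ext u
        rw [component_apply, Finsupp.single_apply, Finsupp.single_apply]
        simp
      rw [this, Finsupp.degree_single]
    · intro j _ hj
      have : component (Finsupp.single (i, v) k) j = 0 := by
        ext u
        rw [component_apply, Finsupp.single_eq_of_ne]
        · rfl
        · exact fun h => hj (congrArg Prod.fst h)
      rw [this, map_zero]
    · intro h
      exact absurd (Finset.mem_univ i) h

theorem card_eq_of_schurCount_ne_zero {lam : Fin r → YoungDiagram} {m : VarIndex r →₀ ℕ}
    (h : schurCount lam m ≠ 0) (i : Fin r) : (lam i).card = (component m i).degree :=
  card_eq_of_kostka_ne_zero (Finset.prod_ne_zero_iff.1 h i (Finset.mem_univ i))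

theorem sum_card_eq_of_schurCount_ne_zero {lam : Fin r → YoungDiagram} {m : VarIndex r →₀ ℕ}
    (h : schurCount lam m ≠ 0) : ∑ i, (lam i).card = m.degree := by
  rw [degree_eq_sum_component]
  exact Finset.sum_congr rfl fun i _ => card_eq_of_schurCount_ne_zero h i

/-- Exponent vectors below `m` are tuples of independently chosen components, so the sum of products
factors; this carries Pieri's rule over to r-partitions. -/
theorem sum_Iic_prod_component (m : VarIndex r →₀ ℕ) (F : Fin r → (ℕ →₀ ℕ) → ℕ) :
    ∑ h ∈ Finset.Iic m, ∏ i, F i (component h i) = ∏ i, ∑ h ∈ Finset.Iic (component m i), F i h := by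
  rw [Finset.prod_univ_sum]
  refine Finset.sum_bij (fun h _ => component h) ?_ ?_ ?_ ?_
  · intro h hh
    rw [Finset.mem_Iic] at hh
    rw [Fintype.mem_piFinset]
    intro i
    rw [Finset.mem_Iic]
    exact fun v => hh (i, v)
  · intro h _ h' _ he
    exact component_injective fun i => congrFun he i
  · intro p hp
    rw [Fintype.mem_piFinset] at hp
    have hp' : ∀ i v, p i v ≤ m (i, v) := fun i v => Finset.mem_Iic.1 (hp i) v
    refine ⟨Finsupp.onFinset m.support (fun x => p x.1 x.2) ?_, ?_, ?_⟩
    · intro x hx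
      have := hp' x.1 x.2
      rw [Finsupp.mem_support_iff]
      simp only [Prod.mk.eta] at this
      omega
    · rw [Finset.mem_Iic]
      exact fun x => hp' x.1 x.2
    · funext i
      ext v
      rfl
  · intro h _
    rfl

open Classical in
/-- Pieri's rule for `r`-partitions. -/
theorem sum_schurCount_of_isHStrip (nu : Fin r → YoungDiagram) {m : VarIndex r →₀ ℕ} {M : ℕ}
    (hM : m.degree ≤ M) :
    ∑ lam ∈ Fintype.piFinset (fun _ : Fin r => cardLE M),
      (if ∀ i, IsHStrip (nu i) (lam i) then schurCount lam m else 0) =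
      ∑ h ∈ Finset.Iic m, schurCount nu h := by
  simp only [schurCount]
  rw [sum_Iic_prod_component m (fun i => kostka (nu i))]
  have e : ∀ i, ∑ h ∈ Finset.Iic (component m i), kostka (nu i) h =
      ∑ μ ∈ cardLE M, if IsHStrip (nu i) μ then kostka μ (component m i) else 0 := by
    intro i
    refine (sum_kostka_of_isHStrip (nu i) (le_trans ?_ hM)).symm
    rw [degree_eq_sum_component]
    exact Finset.single_le_sum (f := fun i => (component m i).degree) (fun _ _ => Nat.zero_le _)
      (Finset.mem_univ i)
  rw [Finset.prod_congr rfl fun i _ => e i, Finset.prod_univ_sum]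
  refine Finset.sum_congr rfl fun lam _ => ?_
  split_ifs with h
  · exact Finset.prod_congr rfl fun i _ => (if_pos (h i)).symm
  · push Not at h
    obtain ⟨i, hi⟩ := h
    exact (Finset.prod_eq_zero (Finset.mem_univ i) (if_neg hi)).symm

theorem component_mapDomain (g : Fin r → Equiv.Perm ℕ) (m : VarIndex r →₀ ℕ) (i : Fin r) :
    component (m.mapDomain (fun p => (p.1, g p.1 p.2))) i = (component m i).mapDomain (g i) := by
  ext v
  obtain ⟨u, rfl⟩ := (g i).surjective v
  have hinj : Function.Injective (fun p : VarIndex r => (p.1, g p.1 p.2)) := by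
    rintro ⟨a, b⟩ ⟨a', b'⟩ h
    obtain rfl : a = a' := congrArg Prod.fst h
    exact Prod.ext rfl ((g a).injective (congrArg Prod.snd h))
  rw [Finsupp.mapDomain_apply (g i).injective, component_apply, component_apply]
  exact Finsupp.mapDomain_apply hinj m (i, u)

theorem schur_mem_SymmR (lam : Fin r → YoungDiagram) : schur lam ∈ SymmR r := by
  refine ⟨⟨∑ i, (lam i).card, fun m h => ?_⟩, fun g m => ?_⟩
  · rw [coeff_schur, Nat.cast_ne_zero] at h
    exact (sum_card_eq_of_schurCount_ne_zero h).ge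
  · rw [coeff_schur, coeff_schur, schurCount, schurCount]
    congr 1
    exact Finset.prod_congr rfl fun i _ => by rw [component_mapDomain, kostka_mapDomain]

theorem SemistandardYoungTableau.row_le_entry {μ : YoungDiagram} (T : SemistandardYoungTableau μ)
    {i j : ℕ} (h : (i, j) ∈ μ) : i ≤ T i j := by
  induction i with
  | zero => exact Nat.zero_le _
  | succ i ih =>
    exact (ih (μ.up_left_mem (Nat.le_succ i) le_rfl h)).trans_lt (T.col_strict (Nat.lt_succ_self i) h)

theorem SemistandardYoungTableau.sum_entries {μ : YoungDiagram} (T : SemistandardYoungTableau μ) :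
    ∑ c ∈ μ.cells, T c.1 c.2 = Finsupp.linearCombination ℕ id T.weight := by
  simp [weight, map_sum]

theorem SemistandardYoungTableau.weight_eq_rowLen {μ : YoungDiagram}
    {T : SemistandardYoungTableau μ} (h : ∀ c ∈ μ.cells, T c.1 c.2 = c.1) (v : ℕ) :
    T.weight v = μ.rowLen v := by
  rw [weight_apply, rowLen_eq_card]
  congr 1
  exact Finset.filter_congr fun c hc => by rw [h c hc]

theorem SemistandardYoungTableau.highestWeight_entry {μ : YoungDiagram} (c : ℕ × ℕ) (hc : c ∈ μ.cells) :
    highestWeight μ c.1 c.2 = c.1 := by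
  rw [highestWeight_apply, if_pos (show (c.1, c.2) ∈ μ from hc)]

/-- Triangularity. In a vanishing combination, take λ in the support with the least sum of row
indices over its cells, and look at the monomial of its highest weight tableau. Every entry of a
tableau is at least its row index, and the sum of the entries is determined by the weight. Hence a
tableau of another shape in the support with that weight would have all entries equal to their row
indices, so that the weight would give back its shape, which would then be λ. -/
theorem linearIndependent_schur (r : ℕ) : LinearIndependent ℚ
    (schur : (Fin r → YoungDiagram) → MvPowerSeries (VarIndex r) ℚ) := by
  classical
  rw [linearIndependent_iff]
  intro l hl
  by_contra hne
  have hne' : l.support.Nonempty := Finsupp.support_nonempty_iff.2 hne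
  obtain ⟨lam, hlam, hmin⟩ := l.support.exists_min_image
    (fun lam => ∑ i, ∑ c ∈ (lam i).cells, c.1) hne'
  let m := tableauWeight (fun i => highestWeight (lam i))
  have hm : ∀ i, component m i = (highestWeight (lam i)).weight := component_tableauWeight _
  have h1 : schurCount lam m ≠ 0 := by
    refine Finset.prod_ne_zero_iff.2 fun i _ => Nat.card_ne_zero.2 ⟨⟨highestWeight (lam i), (hm i).symm⟩,
      inferInstance⟩
  have h2 : ∀ lam' ∈ l.support, lam' ≠ lam → schurCount lam' m = 0 := by
    intro lam' hl' hne
    by_contra h0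
    have hT : ∀ i, ∃ T : SemistandardYoungTableau (lam' i), T.weight = component m i := fun i =>
      nonempty_subtype.1
        (Nat.card_ne_zero.1 (Finset.prod_ne_zero_iff.1 h0 i (Finset.mem_univ i))).1
    choose T hT using hT
    have e1 : ∑ i, ∑ c ∈ (lam' i).cells, T i c.1 c.2 = ∑ i, ∑ c ∈ (lam i).cells, c.1 := by
      refine Finset.sum_congr rfl fun i _ => ?_
      rw [(T i).sum_entries, hT, hm, ← sum_entries]
      exact Finset.sum_congr rfl highestWeight_entry
    have e2 : ∀ i ∈ Finset.univ, ∑ c ∈ (lam' i).cells, c.1 ≤ ∑ c ∈ (lam' i).cells, T i c.1 c.2 :=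
      fun i _ => Finset.sum_le_sum fun c hc => (T i).row_le_entry hc
    have e3 := (Finset.sum_eq_sum_iff_of_le e2).1
      (le_antisymm (Finset.sum_le_sum e2) (e1.le.trans (hmin lam' hl')))
    refine hne (funext fun i => ext_rowLen fun v => ?_)
    have e4 := (Finset.sum_eq_sum_iff_of_le fun c hc => (T i).row_le_entry hc).1
      (e3 i (Finset.mem_univ i))
    rw [← weight_eq_rowLen (T := T i) (fun c hc => (e4 c hc).symm), hT, hm,
      weight_eq_rowLen highestWeight_entry]
  have h3 := congrArg (MvPowerSeries.coeff m) hl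
  rw [Finsupp.linearCombination_apply, Finsupp.sum, map_sum, Finset.sum_eq_single lam, map_zero,
    map_smul, coeff_schur, smul_eq_mul] at h3
  · rcases mul_eq_zero.1 h3 with h | h
    · exact Finsupp.mem_support_iff.1 hlam h
    · exact h1 (Nat.cast_eq_zero.1 h)
  · intro lam' hl' hne
    rw [map_smul, coeff_schur, h2 lam' hl' hne, Nat.cast_zero, smul_zero]
  · exact fun h => absurd hlam h

/-- Linear independence is enough: it defines the map on the span of the Schur functions, and any
linear extension to the whole space has the required values on them. -/
theorem isOmega_omega (r : ℕ) : IsOmega r (omega r) := by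
  have hex : ∃ w, IsOmega r w := by
    let s : (Fin r → YoungDiagram) → SymmR r := fun lam => ⟨schur lam, schur_mem_SymmR lam⟩
    have hs : LinearIndependent ℚ s :=
      LinearIndependent.of_comp (SymmR r).subtype (linearIndependent_schur r)
    obtain ⟨w, hw⟩ := LinearMap.exists_extend
      ((Finsupp.linearCombination ℚ (fun lam => s (conj lam))).comp hs.repr)
    refine ⟨w, fun lam => ⟨schur_mem_SymmR lam, ?_⟩⟩
    have h1 := LinearMap.congr_fun hw ⟨s lam, Submodule.subset_span ⟨lam, rfl⟩⟩
    rw [LinearMap.comp_apply, LinearMap.comp_apply] at h1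
    have h2 : hs.repr ⟨s lam, Submodule.subset_span ⟨lam, rfl⟩⟩ = Finsupp.single lam 1 :=
      hs.repr_eq_single lam _ rfl
    rw [h2, Finsupp.linearCombination_single, one_smul] at h1
    exact congrArg Subtype.val h1
  rw [omega, dif_pos hex]
  exact hex.choose_spec

theorem omegaSeries_sum_smul_schur {ι : Type*} (s : Finset ι) (c : ι → ℚ)
    (lam : ι → Fin r → YoungDiagram) :
    omegaSeries r (∑ t ∈ s, c t • schur (lam t)) = ∑ t ∈ s, c t • schur (conj (lam t)) := by
  have hmem : ∑ t ∈ s, c t • schur (lam t) ∈ SymmR r :=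
    Submodule.sum_mem _ fun t _ => Submodule.smul_mem _ _ (schur_mem_SymmR _)
  rw [omegaSeries, dif_pos hmem]
  have e : (⟨∑ t ∈ s, c t • schur (lam t), hmem⟩ : SymmR r) =
      ∑ t ∈ s, c t • (⟨schur (lam t), schur_mem_SymmR (lam t)⟩ : SymmR r) := by
    refine Subtype.ext ?_
    simp
  rw [e, map_sum, AddSubmonoidClass.coe_finsetSum]
  refine Finset.sum_congr rfl fun t _ => ?_
  rw [map_smul, Submodule.coe_smul]
  obtain ⟨h, hw⟩ := isOmega_omega r (lam t)
  rw [hw]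

end Multi

/-! ### Words with descents in a prescribed set -/

section Descents

variable {α : Type*} [LinearOrder α]

/-- The descent set of a word over a linearly ordered alphabet, positions counted from `1`. -/
noncomputable def descentSet (w : List α) : Finset ℕ := by
  classical
  exact (Finset.Ico 1 w.length).filter
    (fun i => ∃ a b, w[i - 1]? = some a ∧ w[i]? = some b ∧ b < a)

theorem mem_descentSet {w : List α} {i : ℕ} :
    i ∈ descentSet w ↔ ∃ (h1 : 1 ≤ i) (h2 : i < w.length), w[i] < w[i - 1] := by
  classical
  rw [descentSet, Finset.mem_filter, Finset.mem_Ico]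
  constructor
  · rintro ⟨⟨h1, h2⟩, a, b, ha, hb, hab⟩
    rw [List.getElem?_eq_some_iff] at ha hb
    obtain ⟨ha', rfl⟩ := ha
    obtain ⟨hb', rfl⟩ := hb
    exact ⟨h1, h2, hab⟩
  · rintro ⟨h1, h2, h3⟩
    exact ⟨⟨h1, h2⟩, _, _, List.getElem?_eq_getElem _, List.getElem?_eq_getElem _, h3⟩

theorem descentSet_subset_iff {w : List α} {D : Finset ℕ} :
    descentSet w ⊆ D ↔ ∀ (i : ℕ) (h : i + 1 < w.length), i + 1 ∉ D → w[i] ≤ w[i + 1] := by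
  constructor
  · intro hs i h hi
    by_contra hc
    exact hi (hs (mem_descentSet.2 ⟨by omega, h, not_le.1 hc⟩))
  · intro hs i hi
    obtain ⟨h1, h2, h3⟩ := mem_descentSet.1 hi
    by_contra hc
    obtain ⟨i, rfl⟩ : ∃ j, i = j + 1 := ⟨i - 1, by omega⟩
    exact absurd (hs i h2 hc) (not_le.2 h3)

/-- A descent at the junction is allowed by `hp`, and no descent inside `v` is allowed by `hD`, so
the only constraint on `v` is that it be weakly increasing. -/
theorem descentSet_subset_append_iff {u v : List α} {D : Finset ℕ}
    (hp : u.length = 0 ∨ u.length ∈ D)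
    (hD : ∀ i, u.length < i → i < u.length + v.length → i ∉ D) :
    descentSet (u ++ v) ⊆ D ↔ descentSet u ⊆ D ∧ v.Pairwise (· ≤ ·) := by
  rw [← List.isChain_iff_pairwise, List.isChain_iff_getElem, descentSet_subset_iff,
    descentSet_subset_iff]
  constructor
  · intro h
    constructor
    · intro i hi hiD
      have := h i (by rw [List.length_append]; omega) hiD
      rwa [List.getElem_append_left (by omega), List.getElem_append_left hi] at this
    · intro i hi
      have := h (u.length + i) (by rw [List.length_append]; omega)
        (hD _ (by omega) (by omega))
      rwa [List.getElem_append_right (by omega), List.getElem_append_right (by omega),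
        getElem_congr_idx (show u.length + i - u.length = i by omega),
        getElem_congr_idx (show u.length + i + 1 - u.length = i + 1 by omega)] at this
  · rintro ⟨h1, h2⟩ i hi hiD
    rw [List.length_append] at hi
    rcases lt_trichotomy (i + 1) u.length with h | h | h
    · rw [List.getElem_append_left (by omega), List.getElem_append_left h]
      exact h1 i h hiD
    · rcases hp with hp | hp
      · omega
      · exact absurd (h ▸ hp) hiD
    · rw [List.getElem_append_right (by omega), List.getElem_append_right (by omega),
        getElem_congr_idx (show i + 1 - u.length = i - u.length + 1 by omega)]
      exact h2 _ _

/-- The words with given content. -/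
noncomputable def wordsOf {α : Type*} (c : Multiset α) : Finset (List α) := by
  classical
  exact c.lists.toFinset

theorem mem_wordsOf {α : Type*} {c : Multiset α} {w : List α} :
    w ∈ wordsOf c ↔ (w : Multiset α) = c := by
  classical
  rw [wordsOf, Multiset.mem_toFinset, Multiset.mem_lists_iff]
  exact eq_comm

-- After the last allowed descent `p` the word is weakly increasing, so it is the sorted list of the
-- letters not used before: the first `p` letters determine the word. The predicate `Q` allows the
-- same recursion to serve both arbitrary and Yamanouchi words.
open Classical in
theorem card_wordsOf_descentSet_subset (c : Multiset α) (D : Finset ℕ) {p : ℕ}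
    (hpc : p ≤ Multiset.card c)
    (hp : p = 0 ∨ p ∈ D) (hD : ∀ i, p < i → i < Multiset.card c → i ∉ D) (Q : List α → Prop) :
    ((wordsOf c).filter fun w => descentSet w ⊆ D ∧ Q w).card =
      ∑ c' ∈ (Finset.Iic c).filter (fun c' => Multiset.card c' = p),
        ((wordsOf c').filter fun u => descentSet u ⊆ D ∧ Q (u ++ (c - c').sort)).card := by
  rw [Finset.card_eq_sum_card_fiberwise (f := fun w => ((w.take p : List α) : Multiset α))
    (t := (Finset.Iic c).filter (fun c' => Multiset.card c' = p))]
  · refine Finset.sum_congr rfl fun c' hc' => ?_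
    rw [Finset.mem_filter, Finset.mem_Iic] at hc'
    obtain ⟨hle, hcard⟩ := hc'
    have split : ∀ u v : List α, u.length = p → u.length + v.length = Multiset.card c →
        (descentSet (u ++ v) ⊆ D ↔ descentSet u ⊆ D ∧ v.Pairwise (· ≤ ·)) := by
      intro u v hu hv
      refine descentSet_subset_append_iff (hu ▸ hp) fun i h1 h2 => hD i (hu ▸ h1) (hv ▸ h2)
    have fwd : ∀ w : List α, (w : Multiset α) = c → descentSet w ⊆ D →
        ((w.take p : List α) : Multiset α) = c' → descentSet (w.take p) ⊆ D ∧
        w.drop p = (c - c').sort := by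
      rintro w rfl h1 h2
      rw [Multiset.coe_card] at hpc
      have hl : (w.take p).length = p := by rw [List.length_take]; omega
      have h3 := (split (w.take p) (w.drop p) hl (by
        rw [← List.length_append, List.take_append_drop, Multiset.coe_card])).1
        (by rwa [List.take_append_drop])
      refine ⟨h3.1, List.Perm.eq_of_pairwise' h3.2 (Multiset.pairwise_sort _ _) ?_⟩
      rw [← Multiset.coe_eq_coe, Multiset.sort_eq, ← h2]
      have h4 : (w : Multiset α) = (w.take p : List α) + (w.drop p : List α) := by
        rw [Multiset.coe_add, List.take_append_drop]
      rw [h4, add_tsub_cancel_left]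
    refine Finset.card_nbij' (fun w => w.take p) (fun u => u ++ (c - c').sort) ?_ ?_ ?_ ?_
    · intro w hw
      simp only [Finset.coe_filter, Finset.mem_filter, Set.mem_ofPred_eq,
        mem_wordsOf] at hw ⊢
      obtain ⟨⟨h1, h2, h3⟩, h4⟩ := hw
      obtain ⟨h5, h6⟩ := fwd w h1 h2 h4
      exact ⟨h4, h5, by rwa [← h6, List.take_append_drop]⟩
    · intro u hu
      simp only [Finset.coe_filter, Finset.mem_filter, Set.mem_ofPred_eq,
        mem_wordsOf] at hu ⊢
      obtain ⟨h1, h2, h3⟩ := hu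
      have hl : u.length = p := by
        rw [← hcard, ← h1, Multiset.coe_card]
      refine ⟨⟨?_, ?_, h3⟩, ?_⟩
      · rw [← Multiset.coe_add, Multiset.sort_eq, h1]
        exact add_tsub_cancel_of_le hle
      · refine (split u _ hl ?_).2 ⟨h2, Multiset.pairwise_sort _ _⟩
        rw [Multiset.length_sort, Multiset.card_sub hle, hcard, hl]
        omega
      · rw [List.take_append_of_le_length (by omega), List.take_of_length_le (by omega)]
        exact h1
    · intro w hw
      simp only [Finset.coe_filter, Finset.mem_filter, Set.mem_ofPred_eq,
        mem_wordsOf] at hw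
      obtain ⟨⟨h1, h2, h3⟩, h4⟩ := hw
      simp only
      rw [← (fwd w h1 h2 h4).2, List.take_append_drop]
    · intro u hu
      simp only [Finset.coe_filter, Set.mem_ofPred_eq, mem_wordsOf] at hu
      have hl : u.length = p := by
        rw [← hcard, ← hu.1, Multiset.coe_card]
      simp only
      rw [List.take_append_of_le_length (by omega), List.take_of_length_le (by omega)]
  · intro w hw
    simp only [Finset.coe_filter, Set.mem_ofPred_eq, mem_wordsOf] at hw
    simp only [Finset.coe_filter, Set.mem_ofPred_eq, Finset.mem_Iic, Multiset.coe_card,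
      List.length_take]
    obtain ⟨rfl, -⟩ := hw
    refine ⟨Multiset.coe_le.2 (List.take_sublist p w).subperm, ?_⟩
    have : p ≤ w.length := hpc
    omega

end Descents

/-! ### Yamanouchi words for r-tuples of partitions -/

section Yamanouchi

open YoungDiagram

variable {r : ℕ}

/-- Letters of Yamanouchi words: rows of an `r`-tuple of diagrams, ordered so that the growth of a
horizontal strip from the last row of the last component on is weakly increasing. -/
abbrev RowLetter (r : ℕ) : Type := (Fin r ×ₗ ℕ)ᵒᵈ

/-- The letter for row `a` of component `i`. -/
def rowLetter (i : Fin r) (a : ℕ) : RowLetter r := OrderDual.toDual (toLex (i, a))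

theorem rowLetter_lt_iff {i i' : Fin r} {a a' : ℕ} :
    rowLetter i a < rowLetter i' a' ↔ i' < i ∨ (i' = i ∧ a' < a) := by
  rw [rowLetter, rowLetter, OrderDual.toDual_lt_toDual, Prod.Lex.toLex_lt_toLex]

theorem rowLetter_injective {i i' : Fin r} {a a' : ℕ} (h : rowLetter i a = rowLetter i' a') :
    i = i' ∧ a = a' :=
  Prod.ext_iff.1 (toLex.injective (OrderDual.toDual.injective h))

theorem exists_rowLetter (x : RowLetter r) : ∃ i a, x = rowLetter i a :=
  ⟨(ofLex (OrderDual.ofDual x)).1, (ofLex (OrderDual.ofDual x)).2, rfl⟩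

/-- Words all of whose prefixes have an `r`-tuple of partitions as content. -/
def IsYamanouchi (y : List (RowLetter r)) : Prop :=
  ∀ u, u <+: y → ∀ i a, u.count (rowLetter i (a + 1)) ≤ u.count (rowLetter i a)

/-- The multiset that contains the letter of row `a` of `lam i` as often as this row has cells. -/
noncomputable def rowContent (lam : Fin r → YoungDiagram) : Multiset (RowLetter r) :=
  ∑ i, (lam i).cells.val.map fun c => rowLetter i c.1

theorem count_rowContent (lam : Fin r → YoungDiagram) (i : Fin r) (a : ℕ) :
    (rowContent lam).count (rowLetter i a) = (lam i).rowLen a := by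
  rw [rowContent, Multiset.count_sum', Finset.sum_eq_single i]
  · rw [Multiset.count_map, rowLen_eq_card, row, Finset.card_def, Finset.filter_val]
    congr 1
    refine Multiset.filter_congr fun c _ => ?_
    constructor
    · exact fun h => (rowLetter_injective h).2.symm
    · rintro rfl
      rfl
  · intro j _ hj
    rw [Multiset.count_eq_zero, Multiset.mem_map]
    rintro ⟨c, _, h⟩
    exact hj (rowLetter_injective h).1
  · exact fun h => absurd (Finset.mem_univ i) h

theorem card_rowContent (lam : Fin r → YoungDiagram) :
    Multiset.card (rowContent lam) = ∑ i, (lam i).card := by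
  rw [rowContent, Multiset.card_sum]
  refine Finset.sum_congr rfl fun i _ => ?_
  rw [Multiset.card_map]
  rfl

theorem rowContent_injective : Function.Injective (rowContent (r := r)) := by
  intro lam nu h
  refine funext fun i => ext_rowLen fun a => ?_
  rw [← count_rowContent, h, count_rowContent]

theorem rowContent_le_of_isHStrip {nu lam : Fin r → YoungDiagram}
    (h : ∀ i, IsHStrip (nu i) (lam i)) : rowContent nu ≤ rowContent lam := by
  rw [Multiset.le_iff_count]
  intro x
  obtain ⟨i, a, rfl⟩ := exists_rowLetter x
  rw [count_rowContent, count_rowContent]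
  exact (h i a).2

theorem IsYamanouchi.of_prefix {u y : List (RowLetter r)} (h : IsYamanouchi y) (hu : u <+: y) :
    IsYamanouchi u :=
  fun v hv => h v (hv.trans hu)

theorem exists_rowContent_eq {y : List (RowLetter r)} (h : IsYamanouchi y) :
    ∃ lam, rowContent lam = (y : Multiset (RowLetter r)) := by
  have anti : ∀ i : Fin r, Antitone fun a => y.count (rowLetter i a) := fun i =>
    antitone_nat_of_succ_le fun a => h y List.prefix_rfl i a
  have zero : ∀ i : Fin r, ∃ N, y.count (rowLetter i N) = 0 := by
    intro i
    by_contra hc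
    push Not at hc
    have h1 : Function.Injective fun N : ℕ =>
        (⟨rowLetter i N, List.mem_toFinset.2 (List.one_le_count_iff.1 (Nat.one_le_iff_ne_zero.2 (hc N)))⟩ : y.toFinset) :=
      fun N N' he => (rowLetter_injective (Subtype.ext_iff.1 he)).2
    exact not_injective_infinite_finite _ h1
  choose N hN using zero
  refine ⟨fun i => ofRows (N i) fun a => y.count (rowLetter i a), ?_⟩
  ext x
  obtain ⟨i, a, rfl⟩ := exists_rowLetter x
  rw [count_rowContent, rowLen_ofRows (anti i) (hN i), Multiset.coe_count]

/-- In a weakly increasing tail, lower rows come before higher ones within a component. The critical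
moment for rows a and a + 1 is therefore when all letters of row a + 1 have been read and no new
letter of row a has; there the Yamanouchi condition is the horizontal strip inequality. -/
theorem isYamanouchi_append_iff {u v : List (RowLetter r)} (hv : v.Pairwise (· ≤ ·)) :
    IsYamanouchi (u ++ v) ↔ IsYamanouchi u ∧
      ∀ i a, (u ++ v).count (rowLetter i (a + 1)) ≤ u.count (rowLetter i a) := by
  constructor
  · intro h
    refine ⟨h.of_prefix (List.prefix_append u v), fun i a => ?_⟩
    set z := rowLetter i (a + 1)
    have hz : z < rowLetter i a := rowLetter_lt_iff.2 (Or.inr ⟨rfl, Nat.lt_succ_self a⟩)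
    -- The prefix ending at the critical moment: it contains every `z` of `v`, and no letter of row
    -- `a` from `v`.
    have h1 := h (u ++ v.takeWhile (· ≤ z))
      ((List.prefix_append_right_inj u).2 (List.takeWhile_prefix _)) i a
    have h2 : (v.takeWhile (· ≤ z)).count (rowLetter i a) = 0 := by
      rw [List.count_eq_zero]
      intro hm
      have := List.mem_takeWhile_imp hm
      simp only [decide_eq_true_eq] at this
      exact absurd this (not_le.2 hz)
    have h3 : (v.dropWhile (· ≤ z)).count z = 0 := by
      rw [List.count_eq_zero]
      intro hm
      have hs : (v.dropWhile (· ≤ z)).Pairwise (· ≤ ·) :=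
        hv.sublist (List.dropWhile_sublist _)
      have hne : v.dropWhile (· ≤ z) ≠ [] := List.ne_nil_of_mem hm
      have h4 := List.head_dropWhile_not (fun x => decide (x ≤ z)) hne
      simp only [decide_eq_false_iff_not] at h4
      apply h4
      obtain ⟨x, t, hx⟩ := List.exists_cons_of_ne_nil hne
      simp only [hx, List.head_cons]
      rw [hx] at hs hm
      rcases List.mem_cons.1 hm with rfl | hm
      · exact le_rfl
      · exact (List.pairwise_cons.1 hs).1 _ hm
    have h5 : v.count z = (v.takeWhile (· ≤ z)).count z := by
      conv_lhs => rw [← List.takeWhile_append_dropWhile (p := (· ≤ z)) (l := v)]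
      rw [List.count_append, h3, add_zero]
    rw [List.count_append, List.count_append, h2, add_zero] at h1
    rwa [List.count_append, h5]
  · rintro ⟨h1, h2⟩ w hw i a
    rcases List.prefix_or_prefix_of_prefix hw (List.prefix_append u v) with h | h
    · exact h1 w h i a
    · exact ((hw.sublist.count_le _).trans (h2 i a)).trans (h.sublist.count_le _)

open Classical in
/-- The number of Yamanouchi words with content `lam` and descents in `D`. -/
noncomputable def yamanouchiCount (D : Finset ℕ) (lam : Fin r → YoungDiagram) : ℕ :=
  ((wordsOf (rowContent lam)).filter fun y => descentSet y ⊆ D ∧ IsYamanouchi y).card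

-- A Yamanouchi prefix has an r-partition ν as content, and by `isYamanouchi_append_iff` the sorted
-- tail is admissible exactly when it adds a horizontal strip in every component.
open Classical in
theorem yamanouchiCount_eq_sum (lam : Fin r → YoungDiagram) (D : Finset ℕ) {p M : ℕ}
    (hpc : p ≤ ∑ i, (lam i).card) (hM : p ≤ M)
    (hp : p = 0 ∨ p ∈ D) (hD : ∀ i, p < i → i < ∑ i, (lam i).card → i ∉ D) :
    yamanouchiCount D lam = ∑ nu ∈ Fintype.piFinset (fun _ : Fin r => cardLE M),
      if ∑ i, (nu i).card = p ∧ ∀ i, IsHStrip (nu i) (lam i) then yamanouchiCount D nu else 0 := by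
  rw [← card_rowContent] at hpc hD
  rw [yamanouchiCount, card_wordsOf_descentSet_subset _ D hpc hp hD IsYamanouchi, ← Finset.sum_filter]
  have hsplit : ∀ nu : Fin r → YoungDiagram, rowContent nu ≤ rowContent lam →
      ∀ u ∈ wordsOf (rowContent nu), (IsYamanouchi (u ++ (rowContent lam - rowContent nu).sort) ↔
        IsYamanouchi u ∧ ∀ i, IsHStrip (nu i) (lam i)) := by
    intro nu hle u hu
    rw [mem_wordsOf] at hu
    rw [isYamanouchi_append_iff (Multiset.pairwise_sort _ _)]
    refine and_congr_right fun _ => ?_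
    have e1 : ∀ x, (u ++ (rowContent lam - rowContent nu).sort).count x = (rowContent lam).count x := by
      intro x
      rw [← Multiset.coe_count, ← Multiset.coe_add, Multiset.sort_eq, hu, add_tsub_cancel_of_le hle]
    have e2 : ∀ x, u.count x = (rowContent nu).count x := by
      intro x
      rw [← hu, Multiset.coe_count]
    simp only [e1, e2, count_rowContent]
    refine ⟨fun h i a => ⟨h i a, ?_⟩, fun h i a => (h i a).1⟩
    rw [← count_rowContent, ← count_rowContent]
    exact Multiset.le_iff_count.1 hle _
  symm
  -- Contents that do not come from an r-partition, or do not leave horizontal strips, contribute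
  -- zero and are dropped.
  refine Finset.sum_bij_ne_zero (fun nu _ _ => rowContent nu) ?_ ?_ ?_ ?_
  · intro nu hnu _
    rw [Finset.mem_filter] at hnu
    rw [Finset.mem_filter, Finset.mem_Iic, card_rowContent]
    exact ⟨rowContent_le_of_isHStrip hnu.2.2, hnu.2.1⟩
  · exact fun nu _ _ nu' _ _ h => rowContent_injective h
  · intro c' hc' hne
    rw [Finset.mem_filter, Finset.mem_Iic] at hc'
    obtain ⟨u, hu⟩ := Finset.card_ne_zero.1 hne
    rw [Finset.mem_filter] at hu
    obtain ⟨nu, hnu⟩ := exists_rowContent_eq (hu.2.2.of_prefix (List.prefix_append _ _))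
    have hc : c' = rowContent nu := by
      rw [hnu]
      exact (mem_wordsOf.1 hu.1).symm
    subst hc
    have hY := (hsplit nu hc'.1 u hu.1).1 hu.2.2
    have hcard := hc'.2
    rw [card_rowContent] at hcard
    refine ⟨nu, ?_, ?_, rfl⟩
    · rw [Finset.mem_filter, Fintype.mem_piFinset]
      refine ⟨fun i => mem_cardLE.2 (le_trans ?_ (hcard.le.trans hM)), hcard, hY.2⟩
      exact Finset.single_le_sum (f := fun i => (nu i).card) (fun _ _ => Nat.zero_le _)
        (Finset.mem_univ i)
    · refine Finset.card_ne_zero.2 ⟨u, ?_⟩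
      rw [Finset.mem_filter]
      exact ⟨hu.1, hu.2.1, hY.1⟩
  · intro nu hnu _
    rw [Finset.mem_filter] at hnu
    rw [yamanouchiCount]
    congr 1
    refine Finset.filter_congr fun u hu => ?_
    rw [hsplit nu (rowContent_le_of_isHStrip hnu.2.2) u hu]
    exact ⟨fun h => ⟨h.1, h.2, hnu.2.2⟩, fun h => ⟨h.1, h.2.1⟩⟩

end Yamanouchi

/-! ### Coloured words and the matching of the two recursions -/

section Words

variable {r : ℕ}

/-- Letters as indices of variables. -/
def letterEquiv (r : ℕ) : ColoredLetter r ≃ VarIndex r where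
  toFun a := (a.color, a.value)
  invFun p := toLex (OrderDual.toDual p.1, p.2)
  left_inv _ := rfl
  right_inv _ := rfl

/-- The multiset of letters with a given exponent vector. -/
noncomputable def letterContent (m : VarIndex r →₀ ℕ) : Multiset (ColoredLetter r) :=
  (Finsupp.toMultiset m).map (letterEquiv r).symm

theorem card_letterContent (m : VarIndex r →₀ ℕ) : Multiset.card (letterContent m) = m.degree := by
  rw [letterContent, Multiset.card_map, Finsupp.card_toMultiset]
  rfl

theorem letterContent_le_iff {h m : VarIndex r →₀ ℕ} :
    letterContent h ≤ letterContent m ↔ h ≤ m := by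
  classical
  rw [letterContent, letterContent, Multiset.map_le_map_iff (letterEquiv r).symm.injective]
  exact Finsupp.orderIsoMultiset.le_iff_le

theorem letterContent_injective : Function.Injective (letterContent (r := r)) := fun _ _ h =>
  le_antisymm (letterContent_le_iff.1 h.le) (letterContent_le_iff.1 h.ge)

theorem letterContent_surjective : Function.Surjective (letterContent (r := r)) := by
  classical
  intro c
  refine ⟨Multiset.toFinsupp (c.map (letterEquiv r)), ?_⟩
  rw [letterContent, Multiset.toFinsupp_toMultiset, Multiset.map_map]
  simp

/-- The number of words with exponent vector `m` and descents in `D`. -/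
noncomputable def wordCount (D : Finset ℕ) (m : VarIndex r →₀ ℕ) : ℕ :=
  ((wordsOf (letterContent m)).filter fun w => descentSet w ⊆ D).card

/-- The recursion for words with no extra condition. The number of words with descents in `D` thus
obeys a recursion in which the order of the alphabet plays no role. -/
theorem wordCount_eq_sum (m : VarIndex r →₀ ℕ) (D : Finset ℕ) {p : ℕ} (hpm : p ≤ m.degree)
    (hp : p = 0 ∨ p ∈ D) (hD : ∀ i, p < i → i < m.degree → i ∉ D) :
    wordCount D m = ∑ h ∈ (Finset.Iic m).filter (fun h => h.degree = p), wordCount D h := by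
  classical
  rw [← card_letterContent] at hpm hD
  have := card_wordsOf_descentSet_subset _ D hpm hp hD (fun _ => True)
  simp only [and_true] at this
  have e : wordCount D m = ((wordsOf (letterContent m)).filter fun w => descentSet w ⊆ D).card := rfl
  rw [e]
  convert this using 1
  refine Finset.sum_bij (fun h _ => letterContent h) ?_ ?_ ?_ ?_
  · intro h hh
    rw [Finset.mem_filter, Finset.mem_Iic] at hh ⊢
    rw [letterContent_le_iff, card_letterContent]
    exact hh
  · exact fun h _ h' _ he => letterContent_injective he
  · intro c hc
    obtain ⟨h, rfl⟩ := letterContent_surjective c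
    rw [Finset.mem_filter, Finset.mem_Iic, letterContent_le_iff, card_letterContent] at hc
    exact ⟨h, Finset.mem_filter.2 ⟨Finset.mem_Iic.2 hc.1, hc.2⟩, rfl⟩
  · intro h _
    rw [wordCount]

theorem exists_last_mem (D : Finset ℕ) {n : ℕ} (hn : 0 < n) :
    ∃ p < n, (p = 0 ∨ p ∈ D) ∧ ∀ i, p < i → i < n → i ∉ D := by
  induction n with
  | zero => omega
  | succ n ih =>
    by_cases h : n = 0 ∨ n ∈ D
    · exact ⟨n, Nat.lt_succ_self n, h, fun i h1 h2 => by omega⟩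
    · push Not at h
      obtain ⟨p, hp, h1, h2⟩ := ih (Nat.pos_of_ne_zero h.1)
      refine ⟨p, by omega, h1, fun i hi hi' => ?_⟩
      rcases Nat.lt_succ_iff_lt_or_eq.1 hi' with h3 | rfl
      · exact h2 i hi h3
      · exact h.2

theorem yamanouchiCount_bot (D : Finset ℕ) :
    yamanouchiCount D (fun _ : Fin r => (⊥ : YoungDiagram)) = 1 := by
  classical
  rw [yamanouchiCount, Finset.card_eq_one]
  refine ⟨[], ?_⟩
  have h0 : rowContent (fun _ : Fin r => (⊥ : YoungDiagram)) = 0 := by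
    rw [← Multiset.card_eq_zero, card_rowContent]
    simp [YoungDiagram.card]
  ext w
  rw [Finset.mem_filter, mem_wordsOf, Finset.mem_singleton, h0, Multiset.coe_eq_zero]
  constructor
  · exact fun h => h.1
  · rintro rfl
    refine ⟨rfl, by simp [descentSet], ?_⟩
    intro u hu
    rw [List.prefix_nil] at hu
    simp [hu]

theorem wordCount_zero (D : Finset ℕ) : wordCount D (0 : VarIndex r →₀ ℕ) = 1 := by
  classical
  rw [wordCount, Finset.card_eq_one]
  refine ⟨[], ?_⟩
  ext w
  rw [Finset.mem_filter, mem_wordsOf, Finset.mem_singleton, letterContent, map_zero,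
    Multiset.map_zero, Multiset.coe_eq_zero]
  constructor
  · exact fun h => h.1
  · rintro rfl
    exact ⟨rfl, by simp [descentSet]⟩

/-- The enumerative form of the Robinson–Schensted–Knuth correspondence. -/
theorem wordCount_eq_sum_yamanouchiCount (D : Finset ℕ) (m : VarIndex r →₀ ℕ) {M : ℕ}
    (hM : m.degree ≤ M) :
    wordCount D m = ∑ lam ∈ Fintype.piFinset (fun _ : Fin r => cardLE M),
      yamanouchiCount D lam * schurCount lam m := by
  classical
  induction hn : m.degree using Nat.strong_induction_on generalizing m with
  | _ n ih =>
  rcases Nat.eq_zero_or_pos n with h0 | h0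
  · obtain rfl : m = 0 := by
      rw [← Finsupp.degree_eq_zero_iff, hn, h0]
    rw [wordCount_zero, Finset.sum_eq_single (fun _ => ⊥)]
    · rw [yamanouchiCount_bot, schurCount]
      have : ∀ i : Fin r, component (0 : VarIndex r →₀ ℕ) i = 0 := fun i => by ext; rfl
      simp [this, SemistandardYoungTableau.kostka_zero]
    · intro lam _ hne
      by_contra hc
      refine hne (funext fun i => ?_)
      have h1 := card_eq_of_schurCount_ne_zero (right_ne_zero_of_mul hc) i
      have : component (0 : VarIndex r →₀ ℕ) i = 0 := by ext; rfl
      rw [this, map_zero, YoungDiagram.card, Finset.card_eq_zero] at h1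
      exact YoungDiagram.ext h1
    · intro h
      refine absurd (Fintype.mem_piFinset.2 fun i => mem_cardLE.2 ?_) h
      simp [YoungDiagram.card]
  -- Both counts are split at the last position `p` below the length at which `D` allows a descent.
  · obtain ⟨p, hpn, hp, hD⟩ := exists_last_mem D h0
    subst hn
    rw [wordCount_eq_sum m D hpn.le hp hD]
    have e1 : ∀ h ∈ (Finset.Iic m).filter (fun h => h.degree = p), wordCount D h =
        ∑ nu ∈ Fintype.piFinset (fun _ : Fin r => cardLE M),
          if ∑ i, (nu i).card = p then yamanouchiCount D nu * schurCount nu h else 0 := by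
      intro h hh
      rw [Finset.mem_filter] at hh
      rw [ih p hpn h (by omega) hh.2]
      refine Finset.sum_congr rfl fun nu _ => ?_
      split_ifs with h1
      · rfl
      · by_contra hc
        exact h1 ((sum_card_eq_of_schurCount_ne_zero (right_ne_zero_of_mul hc)).trans hh.2)
    rw [Finset.sum_congr rfl e1, Finset.sum_comm]
    have e2 : ∀ nu ∈ Fintype.piFinset (fun _ : Fin r => cardLE M),
        ∑ h ∈ (Finset.Iic m).filter (fun h => h.degree = p),
          (if ∑ i, (nu i).card = p then yamanouchiCount D nu * schurCount nu h else 0) =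
        ∑ lam ∈ Fintype.piFinset (fun _ : Fin r => cardLE M),
          if ∑ i, (nu i).card = p ∧ ∀ i, IsHStrip (nu i) (lam i) then
            yamanouchiCount D nu * schurCount lam m else 0 := by
      intro nu _
      by_cases h1 : ∑ i, (nu i).card = p
      · simp only [h1, if_true, true_and]
        -- A nonzero coefficient of x^h in s_ν forces deg h = |ν| = p, so the degree restriction can
        -- be dropped and Pieri's rule applies.
        rw [← Finset.mul_sum, Finset.sum_filter_of_ne, ← sum_schurCount_of_isHStrip nu hM,
          Finset.mul_sum]
        · exact Finset.sum_congr rfl fun lam _ => mul_ite_zero _ _ _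
        · exact fun h _ hne => (sum_card_eq_of_schurCount_ne_zero hne).symm.trans h1
      · simp only [h1, if_false, false_and, Finset.sum_const_zero]
    rw [Finset.sum_congr rfl e2, Finset.sum_comm]
    refine Finset.sum_congr rfl fun lam _ => ?_
    by_cases hs : schurCount lam m = 0
    · simp [hs]
    · have hc := sum_card_eq_of_schurCount_ne_zero hs
      -- For fixed λ the inner sum over ν is the recursion of the Yamanouchi count. A nonzero
      -- coefficient gives |λ| the degree of `m`, so the same `p` works.
      rw [yamanouchiCount_eq_sum lam D (p := p) (M := M) (by omega) (by omega) hp (by rwa [hc]),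
        Finset.sum_mul]
      exact Finset.sum_congr rfl fun nu _ => (ite_zero_mul _ _ _).symm

end Words

/-! ### Standard r-tableaux as Yamanouchi words -/

namespace StdRTableau

variable {r n : ℕ}

theorem exists_cell (T : StdRTableau r n) (t : Fin n) :
    ∃ p ∈ rCells T.shape, T.tab p.1 p.2.1 p.2.2 = t + 1 :=
  T.standard.surjOn ⟨Nat.succ_le_succ (Nat.zero_le _), t.2⟩

/-- The cell with entry `t + 1`. -/
noncomputable def cellOf (T : StdRTableau r n) (t : Fin n) : Fin r × ℕ × ℕ := (T.exists_cell t).choose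

theorem cellOf_mem (T : StdRTableau r n) (t : Fin n) : T.cellOf t ∈ rCells T.shape :=
  (T.exists_cell t).choose_spec.1

theorem entry_cellOf (T : StdRTableau r n) (t : Fin n) :
    T.tab (T.cellOf t).1 (T.cellOf t).2.1 (T.cellOf t).2.2 = t + 1 :=
  (T.exists_cell t).choose_spec.2

theorem eq_cellOf {T : StdRTableau r n} {t : Fin n} {p : Fin r × ℕ × ℕ} (hp : p ∈ rCells T.shape)
    (h : T.tab p.1 p.2.1 p.2.2 = t + 1) : p = T.cellOf t :=
  T.standard.injOn hp (T.cellOf_mem t) (h.trans (T.entry_cellOf t).symm)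

theorem entry_mem (T : StdRTableau r n) {i : Fin r} {a b : ℕ} (h : (a, b) ∈ T.shape i) :
    1 ≤ T.tab i a b ∧ T.tab i a b ≤ n :=
  T.standard.mapsTo (show ((i, a, b) : Fin r × ℕ × ℕ) ∈ rCells T.shape from h)

/-- The word of the rows of the entries `1, …, n`. -/
noncomputable def rowWord (T : StdRTableau r n) : List (RowLetter r) :=
  List.ofFn fun t => rowLetter (T.cellOf t).1 (T.cellOf t).2.1

theorem length_rowWord (T : StdRTableau r n) : T.rowWord.length = n := List.length_ofFn

theorem rowWord_getElem (T : StdRTableau r n) {t : ℕ} (ht : t < T.rowWord.length) :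
    T.rowWord[t] = rowLetter (T.cellOf ⟨t, T.length_rowWord ▸ ht⟩).1
      (T.cellOf ⟨t, T.length_rowWord ▸ ht⟩).2.1 := by
  simp [rowWord]

end StdRTableau

theorem List.count_take_succ {α : Type*} [DecidableEq α] {y : List α} {t : ℕ} (ht : t < y.length)
    (x : α) : (y.take (t + 1)).count x = (y.take t).count x + if y[t] = x then 1 else 0 := by
  rw [List.take_succ_eq_append_getElem ht, List.count_append, List.count_singleton]
  simp

namespace StdRTableau

variable {r n : ℕ}

/-- Rows increase, so the entries at most `t` of a row occupy an initial segment of its columns,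
whose length is the number of its letters among the first `t`. Content, the Yamanouchi property and
injectivity of the encoding are all read off from this equivalence. -/
theorem lt_count_take_rowWord (T : StdRTableau r n) (i : Fin r) (a b : ℕ) {t : ℕ} (ht : t ≤ n) :
    b < (T.rowWord.take t).count (rowLetter i a) ↔ (a, b) ∈ T.shape i ∧ T.tab i a b ≤ t := by
  induction t generalizing b with
  | zero =>
    simp only [List.take_zero, List.count_nil, not_lt_zero, false_iff, not_and, not_le]
    exact fun h => (T.entry_mem h).1
  | succ t ih =>
    have ht' : t < T.rowWord.length := by rw [length_rowWord]; omega
    rw [List.count_take_succ ht', rowWord_getElem]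
    set s : Fin n := ⟨t, ht⟩ with hs
    change b < _ + (if rowLetter (T.cellOf s).1 (T.cellOf s).2.1 = rowLetter i a then 1 else 0) ↔ _
    have ih' := fun b => ih b (Nat.le_of_succ_le ht)
    split_ifs with h
    · obtain ⟨h1, h2⟩ := rowLetter_injective h
      set b0 := (T.cellOf s).2.2 with hb0
      have hcell : T.cellOf s = (i, a, b0) := Prod.ext h1 (Prod.ext h2 rfl)
      -- The new letter belongs to this row, and `b0` is the column of the entry t + 1. The cells to
      -- its left have entries at most `t`, since rows weakly increase and entries are distinct;
      -- hence the old count is `b0`.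
      have hmem : (a, b0) ∈ T.shape i := by
        have := T.cellOf_mem s
        rw [hcell] at this
        exact this
      have hent : T.tab i a b0 = t + 1 := by
        have := T.entry_cellOf s
        rw [hcell] at this
        exact this
      have hlt : ∀ b < b0, (a, b) ∈ T.shape i ∧ T.tab i a b ≤ t := by
        intro b hb
        have hm := (T.shape i).up_left_mem le_rfl hb.le hmem
        refine ⟨hm, ?_⟩
        have h3 := (T.tab i).row_weak hb hmem
        by_contra hc
        have h4 : T.tab i a b = s + 1 := by
          change _ = t + 1
          omega
        have h5 := eq_cellOf (p := (i, a, b)) hm h4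
        rw [hcell] at h5
        have : b = b0 := congrArg (fun p => p.2.2) h5
        omega
      have hcount : (T.rowWord.take t).count (rowLetter i a) = b0 := by
        rcases lt_trichotomy ((T.rowWord.take t).count (rowLetter i a)) b0 with h3 | h3 | h3
        · exact absurd ((ih' _).2 (hlt _ h3)) (lt_irrefl _)
        · exact h3
        · have := ((ih' _).1 h3).2
          omega
      rw [hcount]
      constructor
      · intro hb
        rcases Nat.lt_succ_iff_lt_or_eq.1 hb with h3 | rfl
        · exact ⟨(hlt b h3).1, (hlt b h3).2.trans (Nat.le_succ t)⟩
        · exact ⟨hmem, hent.le⟩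
      · rintro ⟨h3, h4⟩
        by_cases h5 : T.tab i a b ≤ t
        · have := (ih' b).2 ⟨h3, h5⟩
          omega
        · have h6 := eq_cellOf (t := s) (p := (i, a, b)) h3 (by
            change T.tab i a b = t + 1
            omega)
          rw [hcell] at h6
          have : b = b0 := congrArg (fun p => p.2.2) h6
          omega
    · rw [add_zero, ih']
      refine and_congr_right fun h3 => ⟨fun h4 => h4.trans (Nat.le_succ t), fun h4 => ?_⟩
      by_contra hc
      have h6 := eq_cellOf (t := s) (p := (i, a, b)) h3 (by
            change T.tab i a b = t + 1
            omega)
      exact h (by rw [← h6])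

theorem rowWord_content (T : StdRTableau r n) :
    (T.rowWord : Multiset (RowLetter r)) = rowContent T.shape := by
  ext x
  obtain ⟨i, a, rfl⟩ := exists_rowLetter x
  rw [count_rowContent, Multiset.coe_count]
  refine eq_of_forall_lt_iff fun b => ?_
  have := T.lt_count_take_rowWord i a b le_rfl
  rw [List.take_of_length_le T.length_rowWord.le] at this
  rw [this, mem_iff_lt_rowLen]
  exact ⟨fun h => h.1, fun h => ⟨h, (T.entry_mem (mem_iff_lt_rowLen.2 h)).2⟩⟩

theorem sum_card_shape (T : StdRTableau r n) : ∑ i, (T.shape i).card = n := by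
  rw [← card_rowContent, ← T.rowWord_content, Multiset.coe_card, length_rowWord]

theorem isYamanouchi_rowWord (T : StdRTableau r n) : IsYamanouchi T.rowWord := by
  intro u hu i a
  have hl : u.length ≤ n := by
    have := hu.length_le
    rwa [length_rowWord] at this
  rw [List.prefix_iff_eq_take.1 hu]
  refine le_of_forall_lt fun b hb => ?_
  rw [T.lt_count_take_rowWord i _ b hl] at hb ⊢
  have := (T.tab i).col_strict (Nat.lt_succ_self a) hb.1
  exact ⟨(T.shape i).up_left_mem (Nat.le_succ a) le_rfl hb.1, this.le.trans hb.2⟩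

theorem descentSet_rowWord (T : StdRTableau r n) : descentSet T.rowWord = T.Des := by
  classical
  ext i
  rw [mem_descentSet, Des, Finset.mem_filter, Finset.mem_Ico]
  have hl := T.length_rowWord
  constructor
  · rintro ⟨h1, h2, h3⟩
    rw [hl] at h2
    rw [rowWord_getElem, rowWord_getElem, rowLetter_lt_iff] at h3
    refine ⟨⟨h1, h2⟩, T.cellOf ⟨i - 1, by omega⟩, T.cellOf_mem _, T.cellOf ⟨i, h2⟩, T.cellOf_mem _,
      ?_, T.entry_cellOf _, h3⟩
    rw [T.entry_cellOf]
    simp only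
    omega
  · rintro ⟨⟨h1, h2⟩, p, hp, p', hp', e, e', h3⟩
    refine ⟨h1, by omega, ?_⟩
    rw [rowWord_getElem, rowWord_getElem, rowLetter_lt_iff]
    rw [eq_cellOf (t := ⟨i, h2⟩) hp' e', eq_cellOf (t := ⟨i - 1, by omega⟩) hp (by
      rw [e]
      simp only
      omega)] at h3
    exact h3

theorem rowWord_injective : Function.Injective (rowWord (r := r) (n := n)) := by
  intro T T' h
  have hs : T.shape = T'.shape := rowContent_injective (by
    rw [← T.rowWord_content, ← T'.rowWord_content, h])
  have ht : ∀ i a b, T.tab i a b = T'.tab i a b := by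
    intro i a b
    by_cases hm : (a, b) ∈ T.shape i
    · have hm' : (a, b) ∈ T'.shape i := by rwa [← hs]
      have key : ∀ t ≤ n, (T.tab i a b ≤ t ↔ T'.tab i a b ≤ t) := by
        intro t htn
        have h1 := T.lt_count_take_rowWord i a b htn
        have h2 := T'.lt_count_take_rowWord i a b htn
        rw [h] at h1
        simp only [hm, hm', true_and] at h1 h2
        rw [← h1, h2]
      exact le_antisymm ((key _ (T'.entry_mem hm').2).2 le_rfl) ((key _ (T.entry_mem hm).2).1 le_rfl)
    · have hm' : (a, b) ∉ T'.shape i := by rwa [← hs]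
      rw [(T.tab i).zeros hm, (T'.tab i).zeros hm']
  obtain ⟨s, t, h1⟩ := T
  obtain ⟨s', t', h1'⟩ := T'
  obtain rfl : s = s' := hs
  obtain rfl : t = t' := funext fun i => SemistandardYoungTableau.ext (ht i)
  rfl

section OfWord

variable {lam : Fin r → YoungDiagram} {y : List (RowLetter r)}

open Classical in
/-- The position of the `b`-th letter `rowLetter i a` in a word with content `lam`. -/
noncomputable def position (lam : Fin r → YoungDiagram) (y : List (RowLetter r)) (i : Fin r)
    (a b : ℕ) : ℕ :=
  if (a, b) ∈ lam i then sInf {t | b < (y.take t).count (rowLetter i a)} else 0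

theorem position_le_iff (hy : (y : Multiset (RowLetter r)) = rowContent lam) {i : Fin r} {a b : ℕ}
    (h : (a, b) ∈ lam i) (t : ℕ) :
    position lam y i a b ≤ t ↔ b < (y.take t).count (rowLetter i a) := by
  rw [position, if_pos h]
  have hne : {t | b < (y.take t).count (rowLetter i a)}.Nonempty := by
    refine ⟨y.length, ?_⟩
    rw [Set.mem_ofPred_eq, List.take_length, ← Multiset.coe_count, hy, count_rowContent]
    exact mem_iff_lt_rowLen.1 h
  constructor
  · intro h1
    have h2 := Nat.sInf_mem hne
    rw [Set.mem_ofPred_eq] at h2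
    exact h2.trans_le ((List.take_sublist_take_left h1).count_le _)
  · exact fun h1 => Nat.sInf_le h1

theorem position_eq_succ_iff (hy : (y : Multiset (RowLetter r)) = rowContent lam) {i : Fin r}
    {a b : ℕ} (h : (a, b) ∈ lam i) {t : ℕ} (ht : t < y.length) :
    position lam y i a b = t + 1 ↔ y[t] = rowLetter i a ∧ b = (y.take t).count (rowLetter i a) := by
  have h1 := position_le_iff hy h t
  have h2 := position_le_iff hy h (t + 1)
  rw [List.count_take_succ ht] at h2
  split_ifs at h2 with h3
  · simp only [h3, true_and]
    omega
  · simp only [h3, false_and, iff_false]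
    omega

theorem position_mem (hy : (y : Multiset (RowLetter r)) = rowContent lam) {i : Fin r} {a b : ℕ}
    (h : (a, b) ∈ lam i) : 1 ≤ position lam y i a b ∧ position lam y i a b ≤ y.length := by
  have h1 := position_le_iff hy h 0
  rw [List.take_zero, List.count_nil] at h1
  refine ⟨by omega, (position_le_iff hy h _).2 ?_⟩
  rw [List.take_length, ← Multiset.coe_count, hy, count_rowContent]
  exact mem_iff_lt_rowLen.1 h

theorem exists_position (hy : (y : Multiset (RowLetter r)) = rowContent lam) {i : Fin r} {a b : ℕ}
    (h : (a, b) ∈ lam i) : ∃ t, ∃ ht : t < y.length, position lam y i a b = t + 1 ∧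
      y[t] = rowLetter i a ∧ b = (y.take t).count (rowLetter i a) := by
  have h1 := position_mem hy h
  have ht : position lam y i a b - 1 < y.length := by omega
  have he : position lam y i a b = position lam y i a b - 1 + 1 := by omega
  exact ⟨_, ht, he, (position_eq_succ_iff hy h ht).1 he⟩

/-- The inverse encoding: a cell in column `b` of a row receives the one-based position of the
occurrence number `b`, counted from zero, of the letter of that row. Rows increase by construction,
and columns because every prefix has partition content. -/
theorem exists_rowWord_eq (hy : (y : Multiset (RowLetter r)) = rowContent lam)
    (hY : IsYamanouchi y) (hn : y.length = n) :
    ∃ T : StdRTableau r n, T.shape = lam ∧ T.rowWord = y := by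
  classical
  have anti : ∀ i t, Antitone fun a => (y.take t).count (rowLetter i a) := fun i t =>
    antitone_nat_of_succ_le fun a => hY _ (List.take_prefix _ _) i a
  let tab : ∀ i, SemistandardYoungTableau (lam i) := fun i =>
    { entry := position lam y i
      row_weak' := by
        intro a b1 b2 hb hc
        rw [position_le_iff hy ((lam i).up_left_mem le_rfl hb.le hc)]
        exact hb.trans ((position_le_iff hy hc _).1 le_rfl)
      col_strict' := by
        intro a1 a2 b ha hc
        obtain ⟨t, ht, h1, h2, h3⟩ := exists_position hy hc
        rw [h1, Nat.lt_succ_iff, position_le_iff hy ((lam i).up_left_mem ha.le le_rfl hc)]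
        -- Position t + 1 supplies occurrence `b` of the lower row. By the Yamanouchi condition the
        -- upper row already has more than `b` letters there, and the letter just read is not one of
        -- them.
        have h4 : (y.take (t + 1)).count (rowLetter i a2) ≤ (y.take (t + 1)).count (rowLetter i a1) :=
          anti i (t + 1) ha.le
        rw [List.count_take_succ ht, List.count_take_succ ht, if_pos h2, h2, if_neg] at h4
        · omega
        · intro h
          have := (rowLetter_injective h).2
          omega
      zeros' := fun h => if_neg h }
  have hT : ∀ i a b, tab i a b = position lam y i a b := fun _ _ _ => rfl
  have hstd : Set.BijOn (fun p : Fin r × ℕ × ℕ => tab p.1 p.2.1 p.2.2) (rCells lam)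
      (Set.Icc 1 n) := by
    refine ⟨?_, ?_, ?_⟩
    · rintro ⟨i, a, b⟩ hp
      subst hn
      exact position_mem hy hp
    · rintro ⟨i, a, b⟩ hp ⟨i', a', b'⟩ hp' he
      change position lam y i a b = position lam y i' a' b' at he
      obtain ⟨t, ht, h1, h2, h3⟩ := exists_position (i := i) (a := a) (b := b) hy hp
      obtain ⟨t', ht', h1', h2', h3'⟩ := exists_position (i := i') (a := a') (b := b') hy hp'
      obtain rfl : t = t' := by omega
      obtain ⟨rfl, rfl⟩ := rowLetter_injective (h2.symm.trans h2')
      rw [h3, h3']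
    · rintro v ⟨hv1, hv2⟩
      obtain ⟨t, rfl⟩ : ∃ t, v = t + 1 := ⟨v - 1, by omega⟩
      have ht : t < y.length := by omega
      obtain ⟨i, a, hia⟩ := exists_rowLetter y[t]
      have hm : (a, (y.take t).count (rowLetter i a)) ∈ lam i := by
        rw [mem_iff_lt_rowLen, ← count_rowContent, ← hy, Multiset.coe_count]
        refine lt_of_lt_of_le ?_ ((List.take_sublist (t + 1) y).count_le _)
        rw [List.count_take_succ ht, if_pos hia]
        exact Nat.lt_succ_self _
      exact ⟨(i, a, _), hm, (position_eq_succ_iff hy hm ht).2 ⟨hia, rfl⟩⟩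
  refine ⟨⟨lam, tab, hstd⟩, rfl, ?_⟩
  refine List.ext_getElem (by rw [length_rowWord, hn]) fun t h1 h2 => ?_
  rw [rowWord_getElem]
  set T : StdRTableau r n := ⟨lam, tab, hstd⟩
  set s : Fin n := ⟨t, T.length_rowWord ▸ h1⟩
  have hm := T.cellOf_mem s
  have he := T.entry_cellOf s
  exact ((position_eq_succ_iff hy hm h2).1 he).1.symm

end OfWord

open Classical in
theorem yamanouchiCount_eq_card [Fintype (StdRTableau r n)] (D : Finset ℕ)
    (lam : Fin r → YoungDiagram) (hlam : ∑ i, (lam i).card = n) :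
    yamanouchiCount D lam =
      (Finset.univ.filter fun T : StdRTableau r n => T.Des ⊆ D ∧ T.shape = lam).card := by
  symm
  refine Finset.card_nbij (fun T => T.rowWord) ?_ ?_ ?_
  · intro T hT
    rw [Finset.mem_coe, Finset.mem_filter] at hT
    rw [Finset.mem_coe, Finset.mem_filter, mem_wordsOf, descentSet_rowWord]
    exact ⟨hT.2.2 ▸ T.rowWord_content, hT.2.1, T.isYamanouchi_rowWord⟩
  · exact fun T _ T' _ h => rowWord_injective h
  · intro y hy
    rw [Finset.mem_coe, Finset.mem_filter, mem_wordsOf] at hy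
    obtain ⟨T, hT, rfl⟩ := exists_rowWord_eq (n := n) hy.1 hy.2.2 (by
      rw [← hlam, ← card_rowContent, ← hy.1, Multiset.coe_card])
    refine ⟨T, ?_, rfl⟩
    rw [Finset.mem_coe, Finset.mem_filter, ← descentSet_rowWord]
    exact ⟨Finset.mem_univ _, hy.2.1, hT⟩

theorem wordCount_eq_sum_tableaux [Fintype (StdRTableau r n)] (D : Finset ℕ)
    (m : VarIndex r →₀ ℕ) (hm : m.degree = n) :
    wordCount D m = ∑ T : StdRTableau r n, if T.Des ⊆ D then schurCount T.shape m else 0 := by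
  classical
  rw [wordCount_eq_sum_yamanouchiCount D m le_rfl, ← Finset.sum_filter]
  have hmaps : ∀ T ∈ Finset.univ.filter (fun T : StdRTableau r n => T.Des ⊆ D),
      T.shape ∈ Fintype.piFinset (fun _ : Fin r => cardLE m.degree) := by
    intro T _
    rw [Fintype.mem_piFinset]
    intro i
    rw [mem_cardLE, hm]
    refine le_trans ?_ T.sum_card_shape.le
    exact Finset.single_le_sum (f := fun i => (T.shape i).card) (fun _ _ => Nat.zero_le _)
      (Finset.mem_univ i)
  rw [← Finset.sum_fiberwise_of_maps_to hmaps]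
  refine Finset.sum_congr rfl fun lam _ => ?_
  rw [Finset.sum_congr rfl (g := fun _ => schurCount lam m) (fun T hT => by
    rw [(Finset.mem_filter.1 hT).2]), Finset.sum_const, smul_eq_mul, Finset.filter_filter]
  by_cases hs : schurCount lam m = 0
  · rw [hs, mul_zero, mul_zero]
  · rw [yamanouchiCount_eq_card D lam ((sum_card_eq_of_schurCount_ne_zero hs).trans hm)]

/-- Möbius inversion on the Boolean lattice, by induction on the set. It passes from descent sets
contained in `D` to descent sets equal to `D`. -/
theorem _root_.Finset.eq_of_sum_powerset_eq {β M : Type*} [DecidableEq β] [AddCommGroup M]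
    {f g : Finset β → M} (h : ∀ D : Finset β, ∑ E ∈ D.powerset, f E = ∑ E ∈ D.powerset, g E) : f = g := by
  funext D
  induction D using Finset.strongInduction with
  | H D ih =>
    have := h D
    rw [← Finset.sum_erase_add _ _ (Finset.mem_powerset_self D),
      ← Finset.sum_erase_add _ g (Finset.mem_powerset_self D)] at this
    rw [Finset.sum_congr rfl (g := g)] at this
    · exact add_left_cancel this
    · intro E hE
      rw [Finset.mem_erase, Finset.mem_powerset] at hE
      exact ih E (Finset.ssubset_iff_subset_ne.2 ⟨hE.2, hE.1⟩)

/-- Sums over words depending on the descent set only, in terms of standard tableaux. -/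
theorem sum_words_eq_sum_tableaux [Fintype (StdRTableau r n)] {M : Type*} [AddCommGroup M]
    (F : Finset ℕ → M) (m : VarIndex r →₀ ℕ) (hm : m.degree = n) :
    ∑ w ∈ wordsOf (letterContent m), F (descentSet w) =
      ∑ T : StdRTableau r n, schurCount T.shape m • F T.Des := by
  classical
  -- The counts for exact descent sets are compared in ℤ, as inversion needs subtraction.
  have key : (fun D => (((wordsOf (letterContent m)).filter fun w => descentSet w = D).card : ℤ)) =
      fun D => ∑ T : StdRTableau r n, if T.Des = D then (schurCount T.shape m : ℤ) else 0 := by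
    refine Finset.eq_of_sum_powerset_eq fun D => ?_
    rw [Finset.sum_comm]
    have h1 : ∀ T : StdRTableau r n, ∑ E ∈ D.powerset,
        (if T.Des = E then (schurCount T.shape m : ℤ) else 0) =
        ((if T.Des ⊆ D then schurCount T.shape m else 0 : ℕ) : ℤ) := by
      intro T
      rw [Finset.sum_ite_eq]
      simp [Finset.mem_powerset]
    rw [Finset.sum_congr rfl fun T _ => h1 T, ← Nat.cast_sum, ← Nat.cast_sum, ← wordCount_eq_sum_tableaux D m hm,
      wordCount, Nat.cast_inj]
    rw [Finset.card_eq_sum_card_fiberwise (f := descentSet) (t := D.powerset)]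
    · refine Finset.sum_congr rfl fun E hE => ?_
      rw [Finset.filter_filter]
      congr 1
      refine Finset.filter_congr fun w _ => ?_
      rw [Finset.mem_powerset] at hE
      exact ⟨fun h => ⟨h ▸ hE, h⟩, fun h => h.2⟩
    · intro w hw
      rw [Finset.mem_coe, Finset.mem_filter] at hw
      exact Finset.mem_coe.2 (Finset.mem_powerset.2 hw.2)
  -- A finite set containing every descent set that occurs on either side, over which both sums are
  -- regrouped.
  set U := (wordsOf (letterContent m)).image descentSet ∪
    (Finset.univ : Finset (StdRTableau r n)).image Des with hU
  have lhs : ∑ w ∈ wordsOf (letterContent m), F (descentSet w) =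
      ∑ D ∈ U, (((wordsOf (letterContent m)).filter fun w => descentSet w = D).card : ℤ) • F D := by
    rw [← Finset.sum_fiberwise_of_maps_to (t := U) (g := descentSet) (fun w hw =>
      Finset.mem_union_left _ (Finset.mem_image_of_mem _ hw))]
    refine Finset.sum_congr rfl fun D _ => ?_
    rw [Finset.sum_congr rfl (g := fun _ => F D) (fun w hw => by rw [(Finset.mem_filter.1 hw).2]),
      Finset.sum_const, natCast_zsmul]
  have rhs : ∑ T : StdRTableau r n, schurCount T.shape m • F T.Des =
      ∑ D ∈ U, (∑ T : StdRTableau r n, if T.Des = D then (schurCount T.shape m : ℤ) else 0) • F D := by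
    simp only [Finset.sum_smul]
    rw [Finset.sum_comm]
    refine Finset.sum_congr rfl fun T _ => ?_
    simp only [ite_smul, zero_smul]
    rw [Finset.sum_ite_eq, if_pos (Finset.mem_union_right _ (Finset.mem_image_of_mem _
      (Finset.mem_univ T))), natCast_zsmul]
  rw [lhs, rhs]
  exact Finset.sum_congr rfl fun D _ => by rw [congrFun key D]

end StdRTableau

/-! ### Compositions and the complements of their boundary sets -/

section Compositions

theorem Composition.mem_boundaries_iff {n : ℕ} (c : Composition n) (x : Fin (n + 1)) :
    x ∈ c.boundaries ↔ ∃ j ≤ c.length, c.sizeUpTo j = x := by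
  rw [Composition.boundaries, Finset.mem_map]
  constructor
  · rintro ⟨j, -, rfl⟩
    exact ⟨j, Nat.lt_succ_iff.1 j.2, rfl⟩
  · rintro ⟨j, hj, hx⟩
    exact ⟨⟨j, Nat.lt_succ_of_le hj⟩, Finset.mem_univ _, Fin.ext hx⟩

/-- The composition of `n` whose partial sums are the numbers `0, …, n` outside `S`. -/
noncomputable def Composition.ofCompl (n : ℕ) (S : Finset ℕ) (hS : S ⊆ Finset.Ico 1 n) : Composition n :=
  CompositionAsSet.toComposition
    { boundaries := Finset.univ.filter fun x : Fin (n + 1) => (x : ℕ) ∉ S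
      zero_mem := Finset.mem_filter.2 ⟨Finset.mem_univ _, fun h => by
        have := Finset.mem_Ico.1 (hS h)
        simp at this⟩
      getLast_mem := Finset.mem_filter.2 ⟨Finset.mem_univ _, fun h => by
        have := Finset.mem_Ico.1 (hS h)
        simp at this⟩ }

theorem Composition.mem_boundaries_ofCompl {n : ℕ} {S : Finset ℕ} (hS : S ⊆ Finset.Ico 1 n)
    (x : Fin (n + 1)) : x ∈ (Composition.ofCompl n S hS).boundaries ↔ (x : ℕ) ∉ S := by
  rw [Composition.ofCompl, CompositionAsSet.toComposition_boundaries]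
  exact (Finset.mem_filter.trans (and_iff_right (Finset.mem_univ _)))

theorem Composition.eq_of_boundaries_eq {n : ℕ} {c c' : Composition n}
    (h : c.boundaries = c'.boundaries) : c = c' := by
  refine (compositionEquiv n).injective (CompositionAsSet.ext ?_)
  change c.toCompositionAsSet.boundaries = c'.toCompositionAsSet.boundaries
  rw [Composition.toCompositionAsSet_boundaries, Composition.toCompositionAsSet_boundaries, h]

/-- A composition with k parts has k + 1 boundaries among the n + 1 numbers 0, …, n. This is why k
blocks correspond to n - k stars. -/
theorem Composition.card_nonboundaries {n : ℕ} (c : Composition n) {S : Finset ℕ}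
    (hS : S ⊆ Finset.Ico 1 n) (h : ∀ x : Fin (n + 1), x ∈ c.boundaries ↔ (x : ℕ) ∉ S) :
    S.card + c.length = n := by
  have e : S = c.boundariesᶜ.map Fin.valEmbedding := by
    ext i
    simp only [Finset.mem_map, Finset.mem_compl, h, not_not, Fin.valEmbedding_apply]
    constructor
    · intro hi
      have := Finset.mem_Ico.1 (hS hi)
      exact ⟨⟨i, by omega⟩, hi, rfl⟩
    · rintro ⟨x, hx, rfl⟩
      exact hx
  have h1 := Finset.card_compl_add_card c.boundaries
  rw [c.card_boundaries_eq_succ_length, Fintype.card_fin] at h1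
  rw [e, Finset.card_map]
  omega

theorem Multiset.coe_flatten_eq_sum {α : Type*} (L : List (List α)) :
    ((L.flatten : List α) : Multiset α) = (L.map (Multiset.ofList : List α → Multiset α)).sum := by
  induction L with
  | nil => rfl
  | cons l L ih => rw [List.flatten_cons, ← Multiset.coe_add, ih, List.map_cons, List.sum_cons]

end Compositions

/-- The sum of the colours of the letters in a word with given exponent vector. -/
noncomputable def colorWeight {r : ℕ} (m : VarIndex r →₀ ℕ) : ℕ :=
  Finsupp.linearCombination ℕ (fun p : VarIndex r => (p.1 : ℕ)) m

/-! ### Ordered multiset partitions as words with starred descents -/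

namespace ColoredOMP

variable {r n k : ℕ}

theorem colorSum_eq (μ : ColoredOMP r n k) : μ.colorSum = colorWeight μ.weight := by
  simp [colorSum, colorWeight, weight, map_sum]

theorem degree_weight (μ : ColoredOMP r n k) : μ.weight.degree = n := by
  simp [weight, map_sum, Finsupp.degree_single, μ.size]

/-- The blocks, written as decreasing words. -/
def blockWords (μ : ColoredOMP r n k) : List (List (ColoredLetter r)) :=
  List.ofFn fun i => (μ.block i).sort (fun a b => b ≤ a)

theorem word_eq (μ : ColoredOMP r n k) : μ.word = μ.blockWords.flatten := rfl

theorem map_length_blockWords (μ : ColoredOMP r n k) :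
    μ.blockWords.map List.length = List.ofFn fun i => (μ.block i).card := by
  rw [blockWords, List.map_ofFn]
  congr 1
  funext i
  exact Finset.length_sort _

theorem word_content (μ : ColoredOMP r n k) :
    (μ.word : Multiset (ColoredLetter r)) = letterContent μ.weight := by
  let φ : (VarIndex r →₀ ℕ) →+ Multiset (ColoredLetter r) :=
    (Multiset.mapAddMonoidHom (letterEquiv r).symm).comp Finsupp.toMultiset
  have hφ : ∀ m, letterContent m = φ m := fun _ => rfl
  have h1 : ∀ a : ColoredLetter r, φ (Finsupp.single (a.color, a.value) 1) = {a} := by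
    intro a
    rw [← hφ, letterContent, Finsupp.toMultiset_single, one_smul, Multiset.map_singleton]
    exact congrArg _ ((letterEquiv r).symm_apply_apply a)
  rw [hφ, weight, map_sum, word_eq, Multiset.coe_flatten_eq_sum, blockWords, List.map_ofFn,
    List.sum_ofFn]
  refine Finset.sum_congr rfl fun i _ => ?_
  rw [map_sum, Finset.sum_congr rfl fun a _ => h1 a, Finset.sum_multiset_singleton]
  exact Finset.sort_eq _ _

/-- The composition of `n` formed by the block sizes. -/
def composition (μ : ColoredOMP r n k) : Composition n where
  blocks := List.ofFn fun i => (μ.block i).card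
  blocks_pos := by
    intro x hx
    rw [List.mem_ofFn] at hx
    obtain ⟨i, rfl⟩ := hx
    exact Finset.card_pos.2 (μ.nonempty i)
  blocks_sum := by rw [List.sum_ofFn, μ.size]

theorem length_composition (μ : ColoredOMP r n k) : μ.composition.length = k := by
  simp [composition, Composition.length]

theorem sizeUpTo_composition (μ : ColoredOMP r n k) (j : ℕ) : μ.composition.sizeUpTo j =
    ∑ t ∈ Finset.univ.filter (fun t : Fin k => t.val < j), (μ.block t).card := by
  rw [Composition.sizeUpTo, composition, List.sum_take_ofFn]

theorem stars_subset_Ico (μ : ColoredOMP r n k) : μ.stars ⊆ Finset.Ico 1 n :=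
  Finset.filter_subset _ _

theorem mem_boundaries_composition (μ : ColoredOMP r n k) (x : Fin (n + 1)) :
    x ∈ μ.composition.boundaries ↔ (x : ℕ) ∉ μ.stars := by
  classical
  rw [Composition.mem_boundaries_iff, length_composition, stars, Finset.mem_filter, Finset.mem_Ico]
  constructor
  · rintro ⟨j, hj, hx⟩ ⟨_, h⟩
    exact h j hj (by rw [← hx, sizeUpTo_composition])
  · intro h
    by_contra hc
    push Not at hc
    have h0 := hc 0 (Nat.zero_le _)
    have hk := hc k le_rfl
    rw [Composition.sizeUpTo_zero] at h0
    have e : μ.composition.sizeUpTo k = n := by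
      have := μ.composition.sizeUpTo_length
      rwa [length_composition] at this
    rw [e] at hk
    have := x.2
    refine h ⟨by omega, fun j hj he => hc j hj ?_⟩
    rw [sizeUpTo_composition, he]

theorem length_word (μ : ColoredOMP r n k) : μ.word.length = n := by
  rw [← Multiset.coe_card, word_content, card_letterContent, degree_weight]

theorem card_stars (μ : ColoredOMP r n k) : μ.stars.card + k = n := by
  have := μ.composition.card_nonboundaries μ.stars_subset_Ico μ.mem_boundaries_composition
  rwa [length_composition] at this

/-- A block is a set written in decreasing order, hence strictly decreasing, so every position
interior to a block is a descent. -/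
theorem stars_subset_descentSet (μ : ColoredOMP r n k) : μ.stars ⊆ descentSet μ.word := by
  intro i hi
  have hi' := Finset.mem_Ico.1 (μ.stars_subset_Ico hi)
  have hl := μ.length_word
  set c := μ.composition with hc
  set b := c.index ⟨i, hi'.2⟩ with hb
  have h1 := c.sizeUpTo_index_le ⟨i, hi'.2⟩
  have h2 := c.lt_sizeUpTo_index_succ ⟨i, hi'.2⟩
  rw [← hb] at h1 h2
  simp only [Fin.val_succ] at h1 h2
  -- The block found contains the letter with zero-based index `i`; as a star is not a boundary, it
  -- also contains the letter with index i - 1.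
  have h3 : c.sizeUpTo b ≠ i := by
    intro he
    exact (μ.mem_boundaries_composition ⟨i, by omega⟩).1
      ((c.mem_boundaries_iff _).2 ⟨b, b.2.le, he⟩) hi
  have hbk : (b : ℕ) < μ.blockWords.length := by
    rw [blockWords, List.length_ofFn, ← μ.length_composition]
    exact b.2
  have h4 := List.drop_take_succ_flatten_eq_getElem μ.blockWords b hbk
  rw [map_length_blockWords] at h4
  change List.drop (c.sizeUpTo b) (List.take (c.sizeUpTo (b + 1)) μ.word) = _ at h4
  have h5 : (μ.blockWords[(b : ℕ)]).SortedGT := by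
    simp only [blockWords, List.getElem_ofFn]
    exact Finset.sortedGT_sort _
  rw [← h4] at h5
  refine mem_descentSet.2 ⟨hi'.1, by omega, ?_⟩
  have h6 := List.pairwise_iff_getElem.1 h5.pairwise (i - 1 - c.sizeUpTo b) (i - c.sizeUpTo b)
    (by rw [List.length_drop, List.length_take]; omega)
    (by rw [List.length_drop, List.length_take]; omega) (by omega)
  simp only [List.getElem_drop, List.getElem_take] at h6
  rwa [getElem_congr_idx (show c.sizeUpTo b + (i - 1 - c.sizeUpTo b) = i - 1 by omega),
    getElem_congr_idx (show c.sizeUpTo b + (i - c.sizeUpTo b) = i by omega)] at h6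

/-- The stars determine the block sizes, and these determine how the word is cut. -/
theorem eq_of_word_stars {μ μ' : ColoredOMP r n k} (hw : μ.word = μ'.word)
    (hs : μ.stars = μ'.stars) : μ = μ' := by
  have hc : μ.composition = μ'.composition := by
    refine Composition.eq_of_boundaries_eq ?_
    ext x
    rw [mem_boundaries_composition, mem_boundaries_composition, hs]
  have hL : μ.blockWords = μ'.blockWords := by
    refine List.eq_iff_flatten_eq.2 ⟨hw, ?_⟩
    rw [map_length_blockWords, map_length_blockWords]
    exact congrArg Composition.blocks hc
  have hb : μ.block = μ'.block := by
    funext i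
    have := congrFun (List.ofFn_injective hL) i
    rw [← Finset.sort_toFinset (μ.block i) (fun a b => b ≤ a), this, Finset.sort_toFinset]
  cases μ
  cases μ'
  simp only at hb
  subst hb
  rfl

/-- Cut `w` at the positions outside `S`. Inside a piece all positions are starred, hence descents,
so each piece is strictly decreasing and is the sorted list of a set. -/
theorem exists_word_stars {w : List (ColoredLetter r)} {S : Finset ℕ} (hw : w.length = n)
    (hS : S ⊆ descentSet w) (hcard : S.card + k = n) :
    ∃ μ : ColoredOMP r n k, μ.word = w ∧ μ.stars = S := by
  classical
  subst hw
  have hS' : S ⊆ Finset.Ico 1 w.length := fun i hi => by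
    obtain ⟨h1, h2, -⟩ := mem_descentSet.1 (hS hi)
    exact Finset.mem_Ico.2 ⟨h1, h2⟩
  set c := Composition.ofCompl w.length S hS' with hc
  have hcb : ∀ x : Fin (w.length + 1), x ∈ c.boundaries ↔ (x : ℕ) ∉ S :=
    Composition.mem_boundaries_ofCompl hS'
  have hck : c.length = k := by
    have := c.card_nonboundaries hS' hcb
    omega
  set L := w.splitWrtComposition c with hL
  have hLl : L.length = k := by rw [hL, List.length_splitWrtComposition, hck]
  have hLb : L.map List.length = c.blocks := List.map_length_splitWrtComposition w c
  have hsort : ∀ (i : ℕ) (hi : i < L.length), L[i].Pairwise (fun a b => b < a) := by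
    intro i hi
    rw [← List.isChain_iff_pairwise, List.isChain_iff_getElem]
    intro j hj
    have e := List.getElem_splitWrtComposition w c i hi
    rw [List.getElem_of_eq e, List.getElem_of_eq e]
    simp only [List.getElem_drop, List.getElem_take]
    have hj' : j + 1 < (List.drop (c.sizeUpTo i) (List.take (c.sizeUpTo (i + 1)) w)).length := by
      rw [← e]
      exact hj
    rw [List.length_drop, List.length_take] at hj'
    -- An unstarred position would be a partial sum strictly between two consecutive partial sums.
    have hm : c.sizeUpTo i + (j + 1) ∈ S := by
      by_contra hn
      have hlt : c.sizeUpTo i + (j + 1) < w.length + 1 := by omega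
      obtain ⟨t, ht, hte⟩ := (c.mem_boundaries_iff _).1
        ((hcb ⟨c.sizeUpTo i + (j + 1), hlt⟩).2 hn)
      simp only at hte
      have mono := c.monotone_sizeUpTo
      rcases Nat.lt_or_ge i t with h | h
      · have := mono (show i + 1 ≤ t from h)
        omega
      · have := mono h
        omega
    obtain ⟨_, _, h3⟩ := mem_descentSet.1 (hS hm)
    rwa [getElem_congr_idx (show c.sizeUpTo i + (j + 1) - 1 = c.sizeUpTo i + j by omega)] at h3
  have hblock : ∀ i : Fin k, (L[(i : ℕ)]'(hLl.symm ▸ i.2)).toFinset.sort (fun a b => b ≤ a) =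
      L[(i : ℕ)]'(hLl.symm ▸ i.2) := by
    intro i
    have h1 := hsort i (hLl.symm ▸ i.2)
    exact (List.toFinset_sort _ (h1.imp fun h => ne_of_gt h)).2 (h1.imp fun h => le_of_lt h)
  have hcardb : ∀ i : Fin k, (L[(i : ℕ)]'(hLl.symm ▸ i.2)).toFinset.card =
      (L[(i : ℕ)]'(hLl.symm ▸ i.2)).length := fun i => by
    rw [← Finset.length_sort (fun a b => b ≤ a), hblock]
  have hofFn : (List.ofFn fun i : Fin k => L[(i : ℕ)]'(hLl.symm ▸ i.2)) = L :=
    List.ext_getElem (by rw [List.length_ofFn, hLl]) fun i h1 h2 => by rw [List.getElem_ofFn]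
  have hblocks : (List.ofFn fun i : Fin k => (L[(i : ℕ)]'(hLl.symm ▸ i.2)).toFinset.card) =
      c.blocks := by
    simp only [hcardb]
    rw [← hLb]
    conv_rhs => rw [← hofFn]
    rw [List.map_ofFn]
    rfl
  let μ : ColoredOMP r w.length k :=
    { block := fun i => (L[(i : ℕ)]'(hLl.symm ▸ i.2)).toFinset
      nonempty := fun i => by
        rw [← Finset.card_pos]
        refine c.blocks_pos ?_
        rw [← hblocks, List.mem_ofFn]
        exact ⟨i, rfl⟩
      size := by rw [← List.sum_ofFn, hblocks, c.blocks_sum] }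
  refine ⟨μ, ?_, ?_⟩
  · rw [word_eq, blockWords]
    simp only [μ, hblock]
    rw [hofFn]
    exact List.flatten_splitWrtComposition w c
  · have hcomp : μ.composition = c := Composition.ext hblocks
    ext i
    by_cases hi : i < w.length + 1
    · have h1 := μ.mem_boundaries_composition ⟨i, hi⟩
      rw [hcomp, hcb] at h1
      exact not_iff_not.1 h1.symm
    · constructor
      · intro h
        have := Finset.mem_Ico.1 (μ.stars_subset_Ico h)
        omega
      · intro h
        have := Finset.mem_Ico.1 (hS' h)
        omega

open Classical in
theorem card_maj_weight (m : VarIndex r →₀ ℕ) (d : ℕ) (hm : m.degree = n) (hkn : k ≤ n) :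
    Nat.card {μ : ColoredOMP r n k // μ.maj = d ∧ μ.weight = m} =
      ∑ w ∈ wordsOf (letterContent m), (((descentSet w).powersetCard (n - k)).filter fun S =>
        colorWeight m + r * (∑ i ∈ descentSet w, i -
          ∑ i ∈ S, ((descentSet w).filter fun d => i ≤ d).card) = d).card := by
  rw [← Finset.card_sigma, ← Nat.card_eq_finsetCard]
  refine Nat.card_eq_of_bijective (fun μ => ⟨⟨μ.1.word, μ.1.stars⟩, ?_⟩) ⟨?_, ?_⟩
  · obtain ⟨μ, hd, rfl⟩ := μ
    have := μ.card_stars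
    rw [Finset.mem_sigma, mem_wordsOf, Finset.mem_filter, Finset.mem_powersetCard, ← colorSum_eq]
    exact ⟨μ.word_content, ⟨μ.stars_subset_descentSet, by simp only; omega⟩, hd⟩
  · rintro ⟨μ, h1⟩ ⟨μ', h1'⟩ h
    have h2 := congrArg Subtype.val h
    simp only [Sigma.mk.injEq, heq_eq_eq] at h2
    exact Subtype.ext (eq_of_word_stars h2.1 h2.2)
  · rintro ⟨⟨w, S⟩, h⟩
    rw [Finset.mem_sigma, mem_wordsOf, Finset.mem_filter, Finset.mem_powersetCard] at h
    obtain ⟨h1, ⟨h2, h3⟩, h4⟩ := h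
    simp only at h1 h2 h3 h4
    obtain ⟨μ, rfl, rfl⟩ := exists_word_stars (n := n) (k := k)
      (by rw [← Multiset.coe_card, h1, card_letterContent, hm]) h2 (by omega)
    have hw : μ.weight = m := letterContent_injective (by rw [← word_content, h1])
    refine ⟨⟨μ, ?_, hw⟩, rfl⟩
    rw [← hw, ← colorSum_eq] at h4
    exact h4

end ColoredOMP

/-! ### Gaussian binomials and the sum over sets of stars -/

section QBinomial

/-- The Gaussian binomial coefficients, by the `q`-Pascal rule. -/
noncomputable def gaussPoly : ℕ → ℕ → ℕ[X]
  | _, 0 => 1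
  | 0, _ + 1 => 0
  | d + 1, m + 1 => gaussPoly d (m + 1) + X ^ (d - m) * gaussPoly d m

theorem gaussPoly_eq_zero {d m : ℕ} (h : d < m) : gaussPoly d m = 0 := by
  induction d generalizing m with
  | zero =>
    obtain ⟨m, rfl⟩ : ∃ j, m = j + 1 := ⟨m - 1, by omega⟩
    rfl
  | succ d ih =>
    obtain ⟨m, rfl⟩ : ∃ j, m = j + 1 := ⟨m - 1, by omega⟩
    rw [gaussPoly, ih (by omega), ih (by omega), mul_zero, add_zero]

/-- The subsets are split according to whether they contain the largest element `d`, which is the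
q-Pascal rule; the exponents agree because d + C(m,2) = C(m+1,2) + (d - m) when m ≤ d. -/
theorem sum_powersetCard_range_X_pow (d m : ℕ) :
    ∑ S ∈ (Finset.range d).powersetCard m, (X : ℕ[X]) ^ (∑ i ∈ S, i) =
      X ^ (m.choose 2) * gaussPoly d m := by
  induction d generalizing m with
  | zero =>
    cases m with
    | zero => simp [gaussPoly]
    | succ m =>
      rw [Finset.powersetCard_eq_empty.2 (by simp)]
      simp [gaussPoly]
  | succ d ih =>
    cases m with
    | zero => simp [gaussPoly]
    | succ m =>
      have hd : d ∉ Finset.range d := by simp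
      rw [Finset.range_add_one, Finset.powersetCard_succ_insert hd, Finset.sum_union, ih,
        Finset.sum_image]
      · have e : ∀ S ∈ (Finset.range d).powersetCard m,
            (X : ℕ[X]) ^ (∑ i ∈ insert d S, i) = X ^ d * X ^ (∑ i ∈ S, i) := by
          intro S hS
          rw [Finset.sum_insert fun h => hd ((Finset.mem_powersetCard.1 hS).1 h), pow_add]
        rw [Finset.sum_congr rfl e, ← Finset.mul_sum, ih, gaussPoly, mul_add]
        congr 1
        rcases Nat.lt_or_ge d m with h | h
        · rw [gaussPoly_eq_zero h]
          simp
        · rw [← mul_assoc, ← mul_assoc, ← pow_add, ← pow_add]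
          congr 2
          have := Nat.choose_succ_succ' m 1
          rw [Nat.choose_one_right, one_add_one_eq_two] at this
          omega
      · intro S hS S' hS' h
        rw [Finset.mem_coe, Finset.mem_powersetCard] at hS hS'
        rw [← Finset.erase_insert fun h => hd (hS.1 h), h,
          Finset.erase_insert fun h => hd (hS'.1 h)]
      · rw [Finset.disjoint_left]
        intro S hS hS'
        obtain ⟨S', _, rfl⟩ := Finset.mem_image.1 hS'
        exact hd ((Finset.mem_powersetCard.1 hS).1 (Finset.mem_insert_self d S'))

theorem qInt_add (a b : ℕ) : qInt (a + b) = qInt a + X ^ a * qInt b := by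
  rw [qInt, qInt, qInt, Finset.sum_range_add, Finset.mul_sum]
  simp only [pow_add]

theorem qFact_succ (m : ℕ) : qFact (m + 1) = qFact m * qInt (m + 1) := by
  rw [qFact, qFact, Finset.prod_range_succ]

theorem qFact_ne_zero (m : ℕ) : qFact m ≠ 0 := by
  rw [qFact, Finset.prod_ne_zero_iff]
  intro i _ h
  have := congrArg (eval 1) h
  simp only [qInt, eval_finsetSum, eval_pow, eval_X, one_pow, Finset.sum_const, Finset.card_range,
    eval_zero, nsmul_eq_mul, mul_one] at this
  exact absurd this (by positivity)

/-- Multiplied by the q-factorials, the q-Pascal rule becomes the identity [d - m] + q^{d-m} [m + 1]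
= [d + 1]. Hence the polynomial quotient in `qBinom` is exact, and its coefficients are natural
numbers. -/
theorem gaussPoly_mul_qFact {d m : ℕ} (h : m ≤ d) :
    (gaussPoly d m).map (Nat.castRingHom ℚ) * (qFact m * qFact (d - m)) = qFact d := by
  induction d generalizing m with
  | zero =>
    obtain rfl : m = 0 := by omega
    simp [gaussPoly, qFact]
  | succ d ih =>
    cases m with
    | zero => simp [gaussPoly, qFact]
    | succ m =>
      have hm : m ≤ d := by omega
      rw [gaussPoly, Polynomial.map_add, Polynomial.map_mul, Polynomial.map_pow, map_X, add_mul,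
        Nat.succ_sub_succ]
      have h2 : X ^ (d - m) * (gaussPoly d m).map (Nat.castRingHom ℚ) *
          (qFact (m + 1) * qFact (d - m)) = qFact d * (X ^ (d - m) * qInt (m + 1)) := by
        rw [← ih hm, qFact_succ m]
        ring
      rw [h2]
      rcases hm.eq_or_lt with rfl | hlt
      · rw [gaussPoly_eq_zero (Nat.lt_succ_self m), Polynomial.map_zero, zero_mul, zero_add,
          Nat.sub_self, pow_zero, one_mul, qFact_succ]
      · have h1 : (gaussPoly d (m + 1)).map (Nat.castRingHom ℚ) *
            (qFact (m + 1) * qFact (d - m)) = qFact d * qInt (d - m) := by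
          rw [← ih hlt, show d - m = d - (m + 1) + 1 by omega, qFact_succ (d - (m + 1))]
          ring
        rw [h1, ← mul_add, ← qInt_add, qFact_succ]
        congr 2
        omega

theorem map_gaussPoly (d m : ℕ) : (gaussPoly d m).map (Nat.castRingHom ℚ) = qBinom d m := by
  rw [qBinom]
  split_ifs with h
  · rw [← gaussPoly_mul_qFact h]
    exact (mul_div_cancel_right₀ _
      (mul_ne_zero (qFact_ne_zero _) (qFact_ne_zero _))).symm
  · rw [gaussPoly_eq_zero (by omega), Polynomial.map_zero]

/-- A descent of rank t, counted from zero, has l - t descents weakly above it, with l = |D|. A set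
of stars with rank set S' therefore lowers the sum of the descents by j l minus the sum of S', and
summing over S' gives a Gaussian binomial in q^r. -/
theorem sum_powersetCard_eq_gaussPoly {D : Finset ℕ} (hD : 0 ∉ D) (c r j : ℕ) :
    ∑ S ∈ D.powersetCard j,
      (X : ℕ[X]) ^ (c + r * (∑ i ∈ D, i - ∑ i ∈ S, (D.filter fun d => i ≤ d).card)) =
    X ^ (c + r * ∑ i ∈ D, i + r * j.choose 2 - r * j * D.card) *
      (gaussPoly D.card j).comp (X ^ r) := by
  classical
  set l := D.card with hl
  let e : ℕ → ℕ := fun i => (D.filter fun d => d < i).card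
  have he : ∀ i, e i + (D.filter fun d => i ≤ d).card = l := by
    intro i
    rw [hl, ← Finset.card_filter_add_card_filter_not (s := D) (fun d => d < i)]
    simp only [not_lt, e]
  have hlt : ∀ i ∈ D, ∀ i' ∈ D, i < i' → e i < e i' := by
    intro i hi i' _ h
    refine Finset.card_lt_card (Finset.ssubset_iff_of_subset ?_ |>.2 ⟨i, ?_, ?_⟩)
    · exact Finset.monotone_filter_right D fun d _ hd => lt_trans hd h
    · exact Finset.mem_filter.2 ⟨hi, h⟩
    · simp
  have hinj : Set.InjOn e D := by
    intro i hi i' hi' h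
    rcases lt_trichotomy i i' with h1 | h1 | h1
    · exact absurd h (hlt i hi i' hi' h1).ne
    · exact h1
    · exact absurd h (hlt i' hi' i hi h1).ne'
  have hrange : D.image e = Finset.range l := by
    refine Finset.eq_of_subset_of_card_le ?_ ?_
    · intro x hx
      obtain ⟨i, hi, rfl⟩ := Finset.mem_image.1 hx
      have : 0 < (D.filter fun d => i ≤ d).card :=
        Finset.card_pos.2 ⟨i, Finset.mem_filter.2 ⟨hi, le_rfl⟩⟩
      have := he i
      rw [Finset.mem_range]
      omega
    · rw [Finset.card_image_of_injOn hinj, Finset.card_range]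
  -- As 0 is not in `D`, the element of rank t is at least t + 1. The elements of `D` thus sum to at
  -- least 1 + 2 + ⋯ + l, and none of the natural number subtractions truncates.
  have hpos : ∀ i ∈ D, e i + 1 ≤ i := by
    intro i hi
    have h1 : D.filter (fun d => d < i) ⊆ Finset.Ico 1 i := by
      intro d hd
      rw [Finset.mem_filter] at hd
      rw [Finset.mem_Ico]
      exact ⟨Nat.pos_of_ne_zero fun h => hD (h ▸ hd.1), hd.2⟩
    have h2 := Finset.card_le_card h1
    rw [Nat.card_Ico] at h2
    have : i ≠ 0 := fun h => hD (h ▸ hi)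
    change (D.filter fun d => d < i).card + 1 ≤ i
    omega
  have hsum : ∑ t ∈ Finset.range l, (l - t) ≤ ∑ i ∈ D, i := by
    have h1 : ∑ t ∈ Finset.range l, (l - t) = ∑ t ∈ Finset.range l, (t + 1) := by
      rw [← Finset.sum_range_reflect]
      refine Finset.sum_congr rfl fun t ht => ?_
      rw [Finset.mem_range] at ht
      omega
    rw [h1, ← hrange, Finset.sum_image hinj]
    exact Finset.sum_le_sum hpos
  have hbound : ∀ S ∈ (Finset.range l).powersetCard j, j * l ≤ ∑ i ∈ D, i + ∑ t ∈ S, t := by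
    intro S hS
    rw [Finset.mem_powersetCard] at hS
    have h1 := (Finset.sum_le_sum_of_subset (f := fun t => l - t) hS.1).trans hsum
    have h2 : ∑ t ∈ S, (l - t) + ∑ t ∈ S, t = j * l := by
      rw [← Finset.sum_add_distrib, ← hS.2, ← smul_eq_mul, ← Finset.sum_const]
      refine Finset.sum_congr rfl fun t ht => ?_
      have := Finset.mem_range.1 (hS.1 ht)
      omega
    omega
  have hreindex : ∑ S ∈ D.powersetCard j,
      (X : ℕ[X]) ^ (c + r * (∑ i ∈ D, i - ∑ i ∈ S, (D.filter fun d => i ≤ d).card)) =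
      ∑ S ∈ (Finset.range l).powersetCard j,
        (X : ℕ[X]) ^ (c + r * (∑ i ∈ D, i - (j * l - ∑ t ∈ S, t))) := by
    refine Finset.sum_nbij (fun S => S.image e) ?_ ?_ ?_ ?_
    · intro S hS
      rw [Finset.mem_powersetCard] at hS ⊢
      rw [← hrange, Finset.card_image_of_injOn (hinj.mono hS.1)]
      exact ⟨Finset.image_subset_image hS.1, hS.2⟩
    · intro S hS S' hS' h
      rw [Finset.mem_coe, Finset.mem_powersetCard] at hS hS'
      have h' : e '' (S : Set ℕ) = e '' (S' : Set ℕ) := by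
        rw [← Finset.coe_image, ← Finset.coe_image]
        exact congrArg _ h
      exact Finset.coe_injective ((hinj.image_eq_image_iff hS.1 hS'.1).1 h')
    · intro S hS
      rw [Finset.mem_coe, Finset.mem_powersetCard, ← hrange] at hS
      obtain ⟨S', hS', rfl⟩ := Finset.subset_image_iff.1 hS.1
      refine ⟨S', ?_, rfl⟩
      rw [Finset.mem_coe, Finset.mem_powersetCard, ← hS.2,
        Finset.card_image_of_injOn (hinj.mono hS')]
      exact ⟨hS', rfl⟩
    · intro S hS
      rw [Finset.mem_powersetCard] at hS
      rw [Finset.sum_image (hinj.mono hS.1)]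
      have : ∑ i ∈ S, e i + ∑ i ∈ S, (D.filter fun d => i ≤ d).card = j * l := by
        rw [← Finset.sum_add_distrib, Finset.sum_congr rfl fun i _ => he i, Finset.sum_const, hS.2,
          smul_eq_mul]
      congr 4
      omega
  rw [hreindex]
  rcases Nat.lt_or_ge l j with h | h
  · rw [gaussPoly_eq_zero h, Finset.powersetCard_eq_empty.2 (by simpa using h)]
    simp
  · have hchoose : j * l ≤ ∑ i ∈ D, i + j.choose 2 := by
      have := hbound (Finset.range j) (Finset.mem_powersetCard.2
        ⟨Finset.range_subset_range.2 h, Finset.card_range j⟩)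
      rwa [Finset.sum_range_id, ← Nat.choose_two_right] at this
    -- Both sides are multiplied by q^{r j l}, which may be cancelled, so that the exponents can be
    -- compared without subtraction.
    refine (isRegular_X_pow (R := ℕ) (r * (j * l))).left ?_
    simp only
    have e1 : ∀ S ∈ (Finset.range l).powersetCard j, (X : ℕ[X]) ^ (r * (j * l)) *
        X ^ (c + r * (∑ i ∈ D, i - (j * l - ∑ t ∈ S, t))) =
        X ^ (c + r * ∑ i ∈ D, i) * (X ^ (∑ t ∈ S, t)).comp (X ^ r) := by
      intro S hS
      have h1 := hbound S hS
      have h2 : ∑ t ∈ S, t ≤ j * l := by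
        rw [Finset.mem_powersetCard] at hS
        rw [← hS.2, ← smul_eq_mul, ← Finset.sum_const]
        exact Finset.sum_le_sum fun t ht => (Finset.mem_range.1 (hS.1 ht)).le
      rw [X_pow_comp, ← pow_mul, ← pow_add, ← pow_add]
      congr 1
      have h3 : r * (j * l) + r * (∑ i ∈ D, i - (j * l - ∑ t ∈ S, t)) =
          r * ∑ i ∈ D, i + r * ∑ t ∈ S, t := by
        rw [← mul_add, ← mul_add]
        congr 1
        omega
      omega
    rw [Finset.mul_sum, Finset.sum_congr rfl e1, ← Finset.mul_sum, ← Polynomial.sum_comp,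
      sum_powersetCard_range_X_pow, mul_comp, X_pow_comp, ← pow_mul, ← mul_assoc, ← mul_assoc,
      ← pow_add, ← pow_add]
    congr 2
    have h4 := Nat.mul_le_mul_left r hchoose
    rw [mul_add] at h4
    rw [mul_assoc r j l]
    omega

end QBinomial

/-! ### Schur expansion, ω and positivity -/

section Main

variable {r n : ℕ}

/-- `tableauPoly` with natural number coefficients. -/
noncomputable def tableauPolyNat (k : ℕ) (T : StdRTableau r n) : ℕ[X] :=
  X ^ (T.maj + r * (n - k).choose 2 - r * (n - k) * T.des) *
    (gaussPoly T.des (n - k)).comp (X ^ r)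

theorem map_tableauPolyNat (k : ℕ) (T : StdRTableau r n) :
    (tableauPolyNat k T).map (Nat.castRingHom ℚ) = tableauPoly k T := by
  rw [tableauPolyNat, tableauPoly, Polynomial.map_mul, Polynomial.map_pow, map_X, map_comp,
    Polynomial.map_pow, map_X, map_gaussPoly]

theorem colorWeight_tableauWeight {lam : Fin r → YoungDiagram}
    (T : ∀ i, SemistandardYoungTableau (lam i)) :
    colorWeight (tableauWeight T) = ∑ i : Fin r, (i : ℕ) * (lam i).card := by
  simp only [colorWeight, tableauWeight, map_sum, Finsupp.linearCombination_single, one_mul,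
    Finset.sum_const, smul_eq_mul]
  exact Finset.sum_congr rfl fun i _ => mul_comm _ _

/-- If x^m occurs in s_λ, then `m` has |λ^{(j)}| letters of the j-th colour. So the colour sum of a
word is the component term in the major index of the tableau. -/
theorem colorWeight_eq_of_schurCount_ne_zero {lam : Fin r → YoungDiagram} {m : VarIndex r →₀ ℕ}
    (h : schurCount lam m ≠ 0) : colorWeight m = ∑ i : Fin r, (i : ℕ) * (lam i).card := by
  have hT : ∀ i, ∃ T : SemistandardYoungTableau (lam i), T.weight = component m i := fun i =>
    nonempty_subtype.1 (Nat.card_ne_zero.1 (Finset.prod_ne_zero_iff.1 h i (Finset.mem_univ i))).1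
  choose T hT using hT
  rw [← colorWeight_tableauWeight T, tableauWeight_eq_iff.2 hT]

/-- Coefficientwise in x, partitions become starred words, the sum over stars depends only on the
descent set, words are traded for tableaux, and the sum over stars is then evaluated for each
tableau as a q-binomial. -/
theorem MCoeff_eq_sum [Fintype (StdRTableau r n)] {k : ℕ} (hkn : k ≤ n) (d : ℕ) :
    MCoeff r n k d = ∑ T : StdRTableau r n, (tableauPoly k T).coeff d • schur T.shape := by
  classical
  refine MvPowerSeries.ext fun m => ?_
  rw [map_sum]
  simp only [map_smul, coeff_schur, smul_eq_mul]
  change (Nat.card {μ : ColoredOMP r n k // μ.maj = d ∧ μ.weight = m} : ℚ) = _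
  by_cases hm : m.degree = n
  · rw [ColoredOMP.card_maj_weight m d hm hkn, Nat.cast_sum]
    -- The number of admissible sets of stars, as a function of the descent set alone.
    let F : Finset ℕ → ℚ := fun D => ((D.powersetCard (n - k)).filter fun S =>
        colorWeight m + r * (∑ i ∈ D, i - ∑ i ∈ S, (D.filter fun d => i ≤ d).card) = d).card
    have h1 := StdRTableau.sum_words_eq_sum_tableaux F m hm
    rw [h1]
    refine Finset.sum_congr rfl fun T _ => ?_
    by_cases hs : schurCount T.shape m = 0
    · rw [hs, zero_smul, Nat.cast_zero, mul_zero]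
    · rw [nsmul_eq_mul, mul_comm]
      congr 1
      have h0 : 0 ∉ T.Des := fun h => by
        have := Finset.mem_Ico.1 (Finset.mem_of_mem_filter _ h)
        omega
      have h2 := sum_powersetCard_eq_gaussPoly h0 (colorWeight m) r (n - k)
      have h3 : tableauPolyNat k T = X ^ (colorWeight m + r * ∑ i ∈ T.Des, i +
          r * (n - k).choose 2 - r * (n - k) * T.Des.card) *
          (gaussPoly T.Des.card (n - k)).comp (X ^ r) := by
        rw [tableauPolyNat, StdRTableau.maj, StdRTableau.des,
          colorWeight_eq_of_schurCount_ne_zero hs, add_comm (r * _)]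
      rw [← map_tableauPolyNat, coeff_map, h3, ← h2, finsetSum_coeff]
      simp only [F, coeff_X_pow, Finset.card_filter, eq_comm (a := d)]
      rfl
  · have h1 : IsEmpty {μ : ColoredOMP r n k // μ.maj = d ∧ μ.weight = m} :=
      ⟨fun μ => hm (by rw [← μ.2.2, ColoredOMP.degree_weight])⟩
    rw [Nat.card_of_isEmpty, Nat.cast_zero]
    refine (Finset.sum_eq_zero fun T _ => ?_).symm
    have : schurCount T.shape m = 0 := by
      by_contra hs
      exact hm ((sum_card_eq_of_schurCount_ne_zero hs).symm.trans T.sum_card_shape)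
    rw [this, Nat.cast_zero, mul_zero]

theorem coeff_sum_map_mul_C {ι R : Type*} [CommRing R] [Algebra ℚ R] (s : Finset ι) (p : ι → ℚ[X])
    (a : ι → R) (d : ℕ) :
    (∑ t ∈ s, (p t).map (algebraMap ℚ R) * C (a t)).coeff d = ∑ t ∈ s, (p t).coeff d • a t := by
  rw [finsetSum_coeff]
  refine Finset.sum_congr rfl fun t _ => ?_
  rw [coeff_mul_C, coeff_map, Algebra.smul_def]

theorem MSeries_eq_sum [Fintype (StdRTableau r n)] {k : ℕ} (hkn : k ≤ n) :
    MSeries r n k = ∑ T : StdRTableau r n,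
      (tableauPoly k T).map (algebraMap ℚ (MvPowerSeries (VarIndex r) ℚ)) * C (schur T.shape) := by
  set P := ∑ T : StdRTableau r n,
    (tableauPoly k T).map (algebraMap ℚ (MvPowerSeries (VarIndex r) ℚ)) * C (schur T.shape) with hP
  have hc : ∀ d, MCoeff r n k d = P.coeff d := fun d => by
    rw [hP, coeff_sum_map_mul_C, MCoeff_eq_sum hkn]
  rw [MSeries]
  simp only [hc]
  rw [finsum_eq_sum_of_support_subset (s := P.support)]
  · exact P.as_sum_support.symm
  · intro d hd
    rw [Finset.mem_coe, mem_support_iff]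
    rintro h
    rw [Function.mem_support, h, monomial_zero_right] at hd
    exact hd rfl

theorem omegaQ_MSeries {k : ℕ} (hkn : k ≤ n) : omegaQ r (MSeries r n k) = tableauSum r n k := by
  let _ := Fintype.ofFinite (StdRTableau r n)
  have hω : ∀ d, omegaSeries r ((MSeries r n k).coeff d) = (tableauSum r n k).coeff d := by
    intro d
    rw [MSeries_eq_sum hkn, coeff_sum_map_mul_C, omegaSeries_sum_smul_schur, tableauSum,
      finsum_eq_sum_of_fintype, coeff_sum_map_mul_C]
  -- `omegaQ` runs over the support only, so the other coefficients need ω(0) = 0.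
  have h0 : omegaSeries r (0 : MvPowerSeries (VarIndex r) ℚ) = 0 := by
    have := omegaSeries_sum_smul_schur (r := r) (∅ : Finset ℕ) (fun _ => 0) (fun _ _ => ⊥)
    simpa using this
  ext1 d
  rw [omegaQ, finsetSum_coeff]
  simp only [coeff_monomial]
  rw [Finset.sum_ite_eq' , ← hω]
  split_ifs with h
  · rfl
  · rw [notMem_support_iff.1 h, h0]

/-- All summands are reflected at the same `N`, the degree in q of the whole sum. Reflection
permutes coefficients, and those of `tableauPolyNat` are natural numbers. -/
theorem schurPositive_revQ_tableauSum (r n k : ℕ) : SchurPositive (revQ (tableauSum r n k)) := by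
  classical
  let _ := Fintype.ofFinite (StdRTableau r n)
  set N := (tableauSum r n k).natDegree with hN
  refine ⟨∑ T : StdRTableau r n, Finsupp.single (conj T.shape) (reflect N (tableauPolyNat k T)), ?_⟩
  rw [← Finsupp.sum_finsetSum_index]
  · ext1 d
    rw [revQ, reverse, coeff_reflect, ← hN, tableauSum, finsum_eq_sum_of_fintype,
      coeff_sum_map_mul_C, finsetSum_coeff]
    refine Finset.sum_congr rfl fun T _ => ?_
    rw [Finsupp.sum_single_index]
    · rw [coeff_mul_C, coeff_map, coeff_reflect, ← map_tableauPolyNat, coeff_map]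
      simp [Algebra.smul_def]
    · simp
  · simp
  · intro lam p p'
    rw [Polynomial.map_add, add_mul]

end Main

theorem mainTheorem10 (r n k : ℕ) (hr : 1 ≤ r) (hk : 1 ≤ k) (hkn : k ≤ n) :
    (∀ d : ℕ, (MSeries r n k).coeff d ∈ SymmR r) ∧
      DSeries r n k = revQ (tableauSum r n k) ∧
      SchurPositive (DSeries r n k) := by
  let _ := Fintype.ofFinite (StdRTableau r n)
  have hD : DSeries r n k = revQ (tableauSum r n k) := by rw [DSeries, omegaQ_MSeries hkn]
  refine ⟨fun d => ?_, hD, hD ▸ schurPositive_revQ_tableauSum r n k⟩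
  rw [MSeries_eq_sum hkn, coeff_sum_map_mul_C]
  exact Submodule.sum_mem _ fun T _ => Submodule.smul_mem _ _ (schur_mem_SymmR _)
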